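/- **Setting.** Let $(G_n)$, $G_n=(V_n,E_n)$, be a sequence of finite connected vertex transitive graphs with $|V_n|\to\infty$. Lazy random walk on $G_n$ stays put with probability $\tfrac12$ and otherwise jumps to a uniformly chosen neighbour; $p^t(x,y)$ denotes its $t$-step transition probabilities, $\pi$ the uniform measure on $V_n$, $\mathbf P_x$ the law of the walk started at $x$, and $\tau(y)=\min\{t\ge 0: X(t)=y\}$. Put $$T_{\rm mix}=T_{\rm mix}(G_n)=\min\Big\{t\ge 0:\max_{x,y}\Big|\frac{p^t(x,y)}{\pi(y)}-1\Big|\le\tfrac14\Big\},\qquad g(x,y)=\sum_{t=0}^{T_{\rm mix}}p^t(x,y),$$ $$\Upsilon_n=\frac{T_{\rm mix}}{|V_n|},\quad \Delta_n=\Upsilon_n\log|V_n|,\quad f_c(x,y)=\mathbf P_x[\tau(y)<cT_{\rm mix}],\quad \overline f_c=\sum_y f_c(x,y)\pi(y)$$ ($\overline f_c$ does not depend on $x$). Assume that 1. $T_{\rm mix}(G_n)=o(|V_n|/(\log|V_n|)^2)$ and $T_{\rm mix}(G_n)\to\infty$; 2. $\sum_{y\ne x}g(x,y)^2=o(T_{\rm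 mix}(G_n)/\log|V_n|)$; 3. there is $\rho_0<1$ such that $\mathbf P_x[\tau(y)\wedge\tau(z)\le T_{\rm mix}(G_n)]\le\rho_0$ for all $n$ and all distinct $x,y,z\in V_n$. Let $X_1,X_2$ be independent lazy random walks on $G_n$, each started from $\pi$, with hitting times $\tau_i(x)$, and let $\tau_i(x,y)=\tau_i(x)\wedge\tau_i(y)$. For $x\ne y$ let $H(x,y)=\{\tau_1(x)<\tau_1(y)\wedge\tau_2(x,y)\}$ and $$\widetilde\pi(z;x,y)=\mathbf P[X_2(\tau_1(x,y))=z\mid H(x,y)].$$ **Theorem.** There is a constant $\gamma>0$ such that for every $c\ge2$, as $n\to\infty$, uniformly in $x,y,z\in V_n$ with $x\ne y$, $$\frac{\widetilde\pi(z;x,y)}{\pi(z)}=1+(1+O(\Delta_n))\big(2\overline f_c-f_c(x,z)-f_c(y,z)\big)+O(e^{-\gamma c}\Upsilon_n)+O\big([g(x,z)+g(y,z)+\Delta_n][g(x,y)+\Delta_n]\big).$$ The constants in the $O$-terms do not depend on $c$; the estimate holds for all $n\ge n_0(c)$. In particular, as $n\to\infty$, uniformly in $x,y,z\in V_n$ with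 $x\neq y$, $$\frac{\widetilde\pi(z;x,y)}{\pi(z)}=1+O\big(g(x,y)+g(y,z)+g(x,z)+\Upsilon_n\big).$$ -/

import Mathlib

open Filter Asymptotics MeasureTheory ProbabilityTheory

namespace CompetingWalks

noncomputable section

section Graph

variable {V : Type*} [Fintype V]

open Classical in
/-- One step of lazy random walk on `G` from `x`: stay at `x` with probability `1/2`, otherwise
jump to a uniformly chosen neighbour of `x` (at an isolated vertex the walk stays put). -/
def lazyStep (G : SimpleGraph V) (x : V) : PMF V :=
  if h : (Finset.univ.filter fun y => G.Adj x y).Nonempty then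
    (PMF.uniformOfFintype Bool).bind fun stay =>
      if stay then PMF.pure x else PMF.uniformOfFinset (Finset.univ.filter fun y => G.Adj x y) h
  else PMF.pure x

/-- The one-step transition matrix `p(x,y)` of lazy random walk. -/
def transition (G : SimpleGraph V) : Matrix V V ℝ :=
  Matrix.of fun x y => (lazyStep G x y).toReal

open Classical in
/-- If `x` is not isolated, then `p(x,x) = 1/2`, `p(x,y) = 1 / (2 deg x)` for `y` adjacent to `x`,
and `p(x,y) = 0` otherwise. -/
theorem transition_apply (G : SimpleGraph V) (x y : V)
    (h : (Finset.univ.filter fun y => G.Adj x y).Nonempty) :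
    transition G x y = if x = y then 1 / 2 else
      if G.Adj x y then 1 / (2 * ((Finset.univ.filter fun y => G.Adj x y).card : ℝ)) else 0 := by
  simp only [transition, lazyStep, h, dif_pos, Matrix.of_apply, PMF.bind_apply, tsum_bool,
    PMF.uniformOfFintype_apply]
  by_cases hxy : x = y
  · subst hxy
    simp
  · by_cases ha : G.Adj x y
    · simp [hxy, ha, Ne.symm hxy, mul_comm]
    · simp [hxy, ha, Ne.symm hxy]

open Classical in
/-- The `t`-step transition probability `p^t(x,y)`. -/
def heat (G : SimpleGraph V) (t : ℕ) (x y : V) : ℝ := (transition G ^ t) x y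

/-- The uniform measure `π(y) = 1 / |V|`, which is the stationary distribution of lazy random walk
on a connected vertex transitive graph. -/
def unif (_y : V) : ℝ := 1 / (Fintype.card V : ℝ)

/-- The uniform mixing time `min {t : max_{x,y} |p^t(x,y) / π(y) - 1| ≤ 1/4}`. -/
def Tmix (G : SimpleGraph V) : ℕ :=
  sInf {t : ℕ | ∀ x y : V, |heat G t x y / unif y - 1| ≤ 1 / 4}

/-- The Green's function `g(x,y) = ∑_{t = 0}^{T_mix} p^t(x,y)`. -/
def green (G : SimpleGraph V) (x y : V) : ℝ :=
  ∑ t ∈ Finset.range (Tmix G + 1), heat G t x y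

/-- `Υ = T_mix / |V|`. -/
def Upsilon (G : SimpleGraph V) : ℝ := (Tmix G : ℝ) / (Fintype.card V : ℝ)

/-- `Δ = Υ log |V| = T_mix log |V| / |V|`. -/
def Delta (G : SimpleGraph V) : ℝ := Upsilon G * Real.log (Fintype.card V)

/-- Every vertex can be mapped to every other one by a graph automorphism. -/
def VertexTransitive (G : SimpleGraph V) : Prop :=
  ∀ x y : V, ∃ φ : G ≃g G, φ x = y

end Graph

section Walk

variable {V : Type*} [Fintype V] [MeasurableSpace V] [DiscreteMeasurableSpace V]

/-- The transition kernel: given the trajectory up to time `n`, the next position has the law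
of one lazy step from the current position. -/
def stepKernel (G : SimpleGraph V) (n : ℕ) :
    Kernel (Π _i : Finset.Iic n, V) V where
  toFun ω := (lazyStep G (ω ⟨n, Finset.mem_Iic.2 le_rfl⟩)).toMeasure
  measurable' := Measurable.of_discrete

instance (G : SimpleGraph V) (n : ℕ) : IsMarkovKernel (stepKernel G n) :=
  ⟨fun _ => PMF.toMeasure.isProbabilityMeasure _⟩

/-- The law, on the space `ℕ → V` of trajectories, of lazy random walk with initial law `μ`. -/
def walkLaw (G : SimpleGraph V) (μ : Measure V) : Measure (ℕ → V) :=
  Kernel.trajMeasure (X := fun _ => V) μ (stepKernel G)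

/-- `P_x`: the law of lazy random walk started at `x`. -/
def walkFrom (G : SimpleGraph V) (x : V) : Measure (ℕ → V) := walkLaw G (Measure.dirac x)

/-- `P`: the joint law of two independent lazy random walks `(X₁, X₂)`, each started from the
uniform distribution. -/
def pairLaw (G : SimpleGraph V) : Measure ((ℕ → V) × (ℕ → V)) :=
  (walkLaw G (uniformOn Set.univ)).prod (walkLaw G (uniformOn Set.univ))

/-- The hitting time `min {t ≥ 0 : ω t ∈ A}` of a trajectory (`⊤` if `A` is never hit). -/
def hit (A : Set V) (ω : ℕ → V) : WithTop ℕ :=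
  hittingAfter (fun (t : ℕ) (η : ℕ → V) => η t) A 0 ω

/-- `f_c(x,y) = P_x[τ(y) < c T_mix]`. -/
def hitProb (G : SimpleGraph V) (c : ℝ) (x y : V) : ℝ :=
  (walkFrom G x).real {ω | ∃ t : ℕ, hit {y} ω = t ∧ (t : ℝ) < c * Tmix G}

/-- `f̄_c = ∑_y f_c(x,y) π(y)`; by vertex transitivity it does not depend on `x`. -/
def hitProbMean (G : SimpleGraph V) (c : ℝ) (x : V) : ℝ :=
  ∑ y, hitProb G c x y * unif y

/-- `H(x,y) = {τ₁(x) < τ₁(y), τ₂(x,y)}`: the first visit of the two walks to `{x, y}` is made by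
`X₁` alone, at `x`. Here `ω.1`, `ω.2` are the trajectories of `X₁`, `X₂`. -/
def eventH (x y : V) : Set ((ℕ → V) × (ℕ → V)) :=
  {ω | hit {x} ω.1 < hit {y} ω.1 ∧ hit {x} ω.1 < hit {x, y} ω.2}

/-- `π̃(z;x,y) = P[X₂(τ₁(x,y)) = z | H(x,y)]`. -/
def condLaw (G : SimpleGraph V) (x y z : V) : ℝ :=
  ((pairLaw G)[|eventH x y]).real {ω | ∃ t : ℕ, hit {x, y} ω.1 = t ∧ ω.2 t = z}

end Walk

open Classical in
/-- The standing assumption on the sequence of graphs. -/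
structure StandingAssumption {V : ℕ → Type*} [∀ n, Fintype (V n)] [∀ n, MeasurableSpace (V n)]
    [∀ n, DiscreteMeasurableSpace (V n)] (G : ∀ n, SimpleGraph (V n)) : Prop where
  connected : ∀ n, (G n).Connected
  transitive : ∀ n, VertexTransitive (G n)
  card_tendsto : Tendsto (fun n => Fintype.card (V n)) atTop atTop
  mix_small : (fun n => (Tmix (G n) : ℝ)) =o[atTop]
    fun n => (Fintype.card (V n) : ℝ) / Real.log (Fintype.card (V n)) ^ 2
  mix_tendsto : Tendsto (fun n => Tmix (G n)) atTop atTop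
  green_sq : ∀ x : ∀ n, V n,
    (fun n => ∑ y ∈ Finset.univ.erase (x n), green (G n) (x n) y ^ 2) =o[atTop]
      fun n => (Tmix (G n) : ℝ) / Real.log (Fintype.card (V n))
  hit_miss : ∃ ρ₀ : ℝ, ρ₀ < 1 ∧ ∀ n, ∀ x y z : V n, x ≠ y → x ≠ z → y ≠ z →
    (walkFrom (G n) x).real {ω | min (hit {y} ω) (hit {z} ω) ≤ (Tmix (G n) : WithTop ℕ)} ≤ ρ₀

end

end CompetingWalks

open CompetingWalks

/-! Let `A = {x, y}`, `N = |V|`, and write `s_t(z)`, `e_t(z)` for the probabilities `survive`,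
`escape` that the walk from `z` avoids `A` at times `0, …, t - 1`, respectively `1, …, t`; bars
denote averages over `z`. By reversibility, a stationary walk first meets `A` at time `t` in `x`
with probability `e_t(x)/N`, and avoids `A` through time `t` while being at `z` with probability
`s_{t+1}(z)/N`. Summing over the hitting time gives `π̃(z)/π(z) = ∑ e_t(x) s_{t+1}(z) / ∑ e_t(x)
s̄_{t+1}` (`condLaw_div_unif`).

The last-visit decomposition yields `e_t(x) = e_t(y)` (`escape_pair`), even when no automorphism
exchanges `x` and `y`. Hence `s̄_t - s̄_{t+1} = 2 e_t(x)/N`, and sums weighted by `e_t(x)`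
telescope: the total weight is at most `N/2` and the denominator at least `N/4 - 1/2`.

The dependence of `s_t(z)` on `z` is settled within `m = ⌈c T_mix⌉` steps: the killed law at time
`m` depends little on `z`, and `s_j` is nearly constant in mean, so `s_{m+j}(z) - s̄_{m+j} ≈ (s_m(z)
- s̄_m) s̄_j` (`abs_survive_add_sub_le`). Times `t < m` carry weight at most `m`, so the ratio is `1
+ s_m(z) - s̄_m` up to small errors (`abs_ratio_sub_le`).

Inclusion–exclusion rewrites `s_m(z) - s̄_m` as `2 f̄_c - f_c(x,z) - f_c(y,z)`, up to the
probability of hitting both points, which is at most `f_c(x,y) (f_c(x,z) + f_c(y,z))`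
(`hit_both_le`), and its mean. Finally `f_c ≤ g + O(cΥ)`, and `cΥ ≤ Δ` once `log N ≥ c`. -/

namespace CompetingWalks

open Classical

/-! ### Killed walks: time reversal, last visits, hitting two points -/

section Matrix

variable {V : Type*} [Fintype V]

/-- A symmetric stochastic matrix all of whose powers have constant diagonal. -/
structure HomogeneousWalk (P : Matrix V V ℝ) : Prop where
  nonneg : ∀ x y, 0 ≤ P x y
  row_sum : ∀ x, ∑ y, P x y = 1
  symm : ∀ x y, P x y = P y x
  diag : ∀ (r : ℕ) (x y : V), (P ^ r) x x = (P ^ r) y y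

/-- The matrix `P` killed when leaving a vertex of `A`. -/
noncomputable def killed (P : Matrix V V ℝ) (A : Finset V) : Matrix V V ℝ :=
  Matrix.of fun v w => if v ∈ A then 0 else P v w

/-- The probability that the walk started from `z` avoids `A` at the times `0, …, t - 1`. -/
noncomputable def survive (P : Matrix V V ℝ) (A : Finset V) (t : ℕ) (z : V) : ℝ :=
  ∑ w, (killed P A ^ t) z w

/-- The probability that the walk started from `z` avoids `A` at the times `1, …, t`. -/
noncomputable def escape (P : Matrix V V ℝ) (A : Finset V) (t : ℕ) (z : V) : ℝ :=
  ∑ w, P z w * survive P A t w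

/-- The average of a function on `V`. -/
noncomputable def avg (f : V → ℝ) : ℝ := (∑ z, f z) / Fintype.card V

theorem survive_zero (P : Matrix V V ℝ) (A : Finset V) (z : V) : survive P A 0 z = 1 := by
  simp [survive, Matrix.one_apply]

theorem survive_add (P : Matrix V V ℝ) (A : Finset V) (m j : ℕ) (z : V) :
    survive P A (m + j) z = ∑ w, (killed P A ^ m) z w * survive P A j w := by
  simp only [survive, pow_add, Matrix.mul_apply, Finset.mul_sum]
  exact Finset.sum_comm

theorem survive_succ (P : Matrix V V ℝ) (A : Finset V) (t : ℕ) (z : V) :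
    survive P A (t + 1) z = if z ∈ A then 0 else escape P A t z := by
  rw [add_comm, survive_add, pow_one]
  by_cases h : z ∈ A <;> simp [killed, escape, h]

theorem survive_succ_of_notMem {P : Matrix V V ℝ} {A : Finset V} (t : ℕ) {z : V} (h : z ∉ A) :
    survive P A (t + 1) z = escape P A t z := by
  rw [survive_succ, if_neg h]

theorem survive_succ_of_mem {P : Matrix V V ℝ} {A : Finset V} (t : ℕ) {z : V} (h : z ∈ A) :
    survive P A (t + 1) z = 0 := by
  rw [survive_succ, if_pos h]

namespace HomogeneousWalk

variable {P : Matrix V V ℝ} (hP : HomogeneousWalk P)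
include hP

theorem pow_nonneg (r : ℕ) (x y : V) : 0 ≤ (P ^ r) x y := by
  induction r generalizing x y with
  | zero => simp only [pow_zero, Matrix.one_apply]; split_ifs <;> simp
  | succ r ih =>
    rw [pow_succ, Matrix.mul_apply]
    exact Finset.sum_nonneg fun w _ => mul_nonneg (ih x w) (hP.nonneg w y)

theorem pow_row_sum (r : ℕ) (x : V) : ∑ y, (P ^ r) x y = 1 := by
  induction r generalizing x with
  | zero => simp [Matrix.one_apply]
  | succ r ih =>
    simp only [pow_succ, Matrix.mul_apply]
    rw [Finset.sum_comm]
    simp [← Finset.mul_sum, hP.row_sum, ih]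

theorem pow_symm (r : ℕ) (x y : V) : (P ^ r) x y = (P ^ r) y x := by
  have h : P.transpose = P := by ext i j; exact hP.symm j i
  conv_lhs => rw [← h, ← Matrix.transpose_pow]
  rfl

theorem pow_col_sum (r : ℕ) (x : V) : ∑ y, (P ^ r) y x = 1 := by
  rw [← hP.pow_row_sum r x]
  exact Finset.sum_congr rfl fun y _ => hP.pow_symm r y x

theorem killed_pow_nonneg (A : Finset V) (r : ℕ) (x y : V) : 0 ≤ (killed P A ^ r) x y := by
  induction r generalizing x y with
  | zero => simp only [pow_zero, Matrix.one_apply]; split_ifs <;> simp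
  | succ r ih =>
    rw [pow_succ, Matrix.mul_apply]
    refine Finset.sum_nonneg fun w _ => mul_nonneg (ih x w) ?_
    simp only [killed, Matrix.of_apply]
    split_ifs
    exacts [le_rfl, hP.nonneg w y]

theorem killed_pow_le (A : Finset V) (r : ℕ) (x y : V) : (killed P A ^ r) x y ≤ (P ^ r) x y := by
  induction r generalizing x y with
  | zero => simp
  | succ r ih =>
    rw [pow_succ, pow_succ, Matrix.mul_apply, Matrix.mul_apply]
    refine Finset.sum_le_sum fun w _ =>
      mul_le_mul (ih x w) ?_ ?_ (hP.pow_nonneg r x w)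
    all_goals simp only [killed, Matrix.of_apply]; split_ifs
    exacts [hP.nonneg w y, le_rfl, le_rfl, hP.nonneg w y]

theorem survive_nonneg (A : Finset V) (t : ℕ) (z : V) : 0 ≤ survive P A t z :=
  Finset.sum_nonneg fun w _ => hP.killed_pow_nonneg A t z w

theorem survive_le_one (A : Finset V) (t : ℕ) (z : V) : survive P A t z ≤ 1 := by
  rw [← hP.pow_row_sum t z]
  exact Finset.sum_le_sum fun w _ => hP.killed_pow_le A t z w

theorem escape_nonneg (A : Finset V) (t : ℕ) (z : V) : 0 ≤ escape P A t z :=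
  Finset.sum_nonneg fun w _ => mul_nonneg (hP.nonneg z w) (hP.survive_nonneg A t w)

theorem escape_le_one (A : Finset V) (t : ℕ) (z : V) : escape P A t z ≤ 1 := by
  rw [← hP.row_sum z]
  exact Finset.sum_le_sum fun w _ =>
    mul_le_of_le_one_right (hP.nonneg z w) (hP.survive_le_one A t w)

theorem survive_antitone (A : Finset V) (z : V) : Antitone fun t => survive P A t z := by
  refine antitone_nat_of_succ_le fun t => ?_
  rw [survive_add]
  refine Finset.sum_le_sum fun w _ =>
    mul_le_of_le_one_right (hP.killed_pow_nonneg A t z w) (hP.survive_le_one A 1 w)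

/-- Time reversal: a path ending at `x` that avoids `A` before time `t` becomes, read backwards, a
path from `x` avoiding `A` at times `1, …, t`. The endpoint `x` may itself lie in `A`. -/
theorem sum_killed_pow (A : Finset V) (t : ℕ) (x : V) :
    ∑ z, (killed P A ^ t) z x = escape P A t x := by
  induction t generalizing x with
  | zero => simp [escape, survive_zero, Matrix.one_apply, hP.row_sum]
  | succ t ih =>
    simp only [pow_succ, Matrix.mul_apply]
    rw [Finset.sum_comm]
    simp only [← Finset.sum_mul, ih]
    refine Finset.sum_congr rfl fun v _ => ?_
    rw [survive_succ, hP.symm x v]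
    simp only [killed, Matrix.of_apply]
    split_ifs <;> ring

/-- Last-visit decomposition. -/
theorem survive_renewal (A : Finset V) (t : ℕ) (z : V) :
    survive P A t z =
      1 - ∑ r ∈ Finset.range t, ∑ a ∈ A, (P ^ r) z a * escape P A (t - 1 - r) a := by
  induction t generalizing z with
  | zero => simp [survive_zero]
  | succ t ih =>
    have h1 : escape P A t z =
        1 - ∑ r ∈ Finset.range t, ∑ a ∈ A, (P ^ (r + 1)) z a * escape P A (t - 1 - r) a := by
      rw [escape]
      simp only [ih, mul_sub, mul_one, Finset.sum_sub_distrib, hP.row_sum]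
      congr 1
      simp only [Finset.mul_sum]
      rw [Finset.sum_comm]
      refine Finset.sum_congr rfl fun r _ => ?_
      rw [Finset.sum_comm]
      refine Finset.sum_congr rfl fun a _ => ?_
      rw [pow_succ', Matrix.mul_apply, Finset.sum_mul]
      exact Finset.sum_congr rfl fun w _ => by ring
    have h2 : ∑ a ∈ A, (P ^ 0) z a * escape P A t a = if z ∈ A then escape P A t z else 0 := by
      simp [Matrix.one_apply]
    rw [Finset.sum_range_succ', survive_succ]
    simp only [Nat.add_sub_cancel, Nat.sub_zero]
    rw [h2]
    simp only [Nat.sub_sub, add_comm 1] at h1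
    split_ifs <;> linarith

/-- Survival to time `t + 1` from a point of the pair is `0`, so the renewal identity expresses
`escape` at time `t` through earlier values. Constant diagonals and symmetry make the two recursions
identical. -/
theorem escape_pair (x y : V) (hxy : x ≠ y) (t : ℕ) :
    escape P {x, y} t x = escape P {x, y} t y := by
  induction t using Nat.strong_induction_on with
  | _ t ih =>
    have hx := hP.survive_renewal {x, y} (t + 1) x
    have hy := hP.survive_renewal {x, y} (t + 1) y
    rw [survive_succ_of_mem _ (by simp), Finset.sum_range_succ'] at hx hy
    simp only [Finset.sum_pair hxy, Nat.add_sub_cancel, Nat.sub_zero, pow_zero, Matrix.one_apply,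
      if_true, if_neg hxy, if_neg hxy.symm] at hx hy
    have h : ∑ r ∈ Finset.range t, ((P ^ (r + 1)) x x * escape P {x, y} (t - (r + 1)) x +
          (P ^ (r + 1)) x y * escape P {x, y} (t - (r + 1)) y) =
        ∑ r ∈ Finset.range t, ((P ^ (r + 1)) y x * escape P {x, y} (t - (r + 1)) x +
          (P ^ (r + 1)) y y * escape P {x, y} (t - (r + 1)) y) := by
      refine Finset.sum_congr rfl fun r hr => ?_
      rw [ih (t - (r + 1)) (by have := Finset.mem_range.1 hr; omega), hP.diag _ x y,
        hP.pow_symm _ x y]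
      ring
    linarith

theorem escape_singleton (x y : V) (t : ℕ) : escape P {x} t x = escape P {y} t y := by
  induction t using Nat.strong_induction_on with
  | _ t ih =>
    have hx := hP.survive_renewal {x} (t + 1) x
    have hy := hP.survive_renewal {y} (t + 1) y
    rw [survive_succ_of_mem _ (by simp), Finset.sum_range_succ'] at hx hy
    simp only [Finset.sum_singleton, Nat.add_sub_cancel, Nat.sub_zero, pow_zero, Matrix.one_apply,
      if_true] at hx hy
    have h : ∑ r ∈ Finset.range t, (P ^ (r + 1)) x x * escape P {x} (t - (r + 1)) x =
        ∑ r ∈ Finset.range t, (P ^ (r + 1)) y y * escape P {y} (t - (r + 1)) y := by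
      refine Finset.sum_congr rfl fun r hr => ?_
      rw [ih (t - (r + 1)) (by have := Finset.mem_range.1 hr; omega), hP.diag _ x y]
    linarith

/-- Hitting probabilities are symmetric, since the renewal formula involves the points only through
`P ^ r` between them and a common escape probability. -/
theorem survive_singleton_comm (x y : V) (t : ℕ) : survive P {x} t y = survive P {y} t x := by
  rw [hP.survive_renewal, hP.survive_renewal]
  simp only [Finset.sum_singleton]
  congr 1
  refine Finset.sum_congr rfl fun r _ => ?_
  rw [hP.escape_singleton x y, hP.pow_symm]

/-- First-moment bound by the expected number of visits; this is where the Green's function enters.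
-/
theorem one_sub_survive_singleton_le (x y : V) (t : ℕ) :
    1 - survive P {y} t x ≤ ∑ r ∈ Finset.range t, (P ^ r) x y := by
  rw [hP.survive_renewal, sub_sub_cancel]
  simp only [Finset.sum_singleton]
  exact Finset.sum_le_sum fun r _ =>
    mul_le_of_le_one_right (hP.pow_nonneg r x y) (hP.escape_le_one {y} _ y)

/-- Inclusion–exclusion after one step: the recursion for the probability of hitting both points. -/
theorem escape_pair_eq_add_sum (x y : V) (t : ℕ) (z : V) :
    escape P {x, y} t z = 1 - (1 - escape P {x} t z) - (1 - escape P {y} t z) +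
      ∑ w, P z w * (1 - survive P {x} t w - survive P {y} t w + survive P {x, y} t w) := by
  simp only [escape, mul_add, mul_sub, Finset.sum_add_distrib, Finset.sum_sub_distrib, mul_one,
    hP.row_sum]
  ring

/-- The probability that the walk visits both `x` and `y` before time `t` is nonnegative. -/
theorem hit_both_nonneg (x y : V) (t : ℕ) (z : V) :
    0 ≤ 1 - survive P {x} t z - survive P {y} t z + survive P {x, y} t z := by
  induction t generalizing z with
  | zero => simp [survive_zero]
  | succ t ih =>
    by_cases hx : z = x
    · rw [survive_succ_of_mem (A := {x}) t (by simp [hx]),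
        survive_succ_of_mem (A := {x, y}) t (by simp [hx])]
      linarith [hP.survive_le_one {y} (t + 1) z]
    by_cases hy : z = y
    · rw [survive_succ_of_mem (A := {y}) t (by simp [hy]),
        survive_succ_of_mem (A := {x, y}) t (by simp [hy])]
      linarith [hP.survive_le_one {x} (t + 1) z]
    rw [survive_succ_of_notMem (A := {x}) t (by simp [hx]),
      survive_succ_of_notMem (A := {y}) t (by simp [hy]),
      survive_succ_of_notMem (A := {x, y}) t (by simp [hx, hy]), hP.escape_pair_eq_add_sum]
    have := Finset.sum_nonneg fun w (_ : w ∈ Finset.univ) => mul_nonneg (hP.nonneg z w) (ih w)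
    linarith

/-- The probability that the walk visits both `x` and `y` before time `t` is at most
`(P_z[τ(x) < t] + P_z[τ(y) < t]) * P_x[τ(y) < t]`. -/
theorem hit_both_le (x y : V) (t : ℕ) (z : V) {β : ℝ} (hβ : 1 - survive P {y} t x ≤ β) :
    1 - survive P {x} t z - survive P {y} t z + survive P {x, y} t z ≤
      β * ((1 - survive P {x} t z) + (1 - survive P {y} t z)) := by
  induction t generalizing z with
  | zero => simp [survive_zero]
  | succ t ih =>
    have hβ0 : 0 ≤ β := le_trans (by linarith [hP.survive_le_one {y} (t + 1) x]) hβ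
    -- A free bound `β` lets the same constant serve at the earlier time, where the hitting
    -- probability is smaller.
    have ih' := ih (hβ := by linarith [hP.survive_antitone {y} x (Nat.le_succ t)])
    by_cases hx : z = x
    · rw [survive_succ_of_mem (A := {x}) t (by simp [hx]),
        survive_succ_of_mem (A := {x, y}) t (by simp [hx])]
      subst hx
      nlinarith [hP.survive_le_one {y} (t + 1) z]
    by_cases hy : z = y
    · rw [survive_succ_of_mem (A := {y}) t (by simp [hy]),
        survive_succ_of_mem (A := {x, y}) t (by simp [hy])]
      subst hy
      -- From `y` the walk still has to reach `x`; symmetry turns this into reaching `y` from `x`.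
      rw [hP.survive_singleton_comm]
      nlinarith [hP.survive_le_one {z} (t + 1) x]
    rw [survive_succ_of_notMem (A := {x}) t (by simp [hx]),
      survive_succ_of_notMem (A := {y}) t (by simp [hy]),
      survive_succ_of_notMem (A := {x, y}) t (by simp [hx, hy]), hP.escape_pair_eq_add_sum]
    have h1 := Finset.sum_le_sum fun w (_ : w ∈ Finset.univ) =>
      mul_le_mul_of_nonneg_left (ih' w) (hP.nonneg z w)
    have h2 : ∑ w, P z w * (β * ((1 - survive P {x} t w) + (1 - survive P {y} t w))) =
        β * ((1 - escape P {x} t z) + (1 - escape P {y} t z)) := by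
      have : ∀ w, P z w * (β * ((1 - survive P {x} t w) + (1 - survive P {y} t w))) =
          β * ((P z w - P z w * survive P {x} t w) + (P z w - P z w * survive P {y} t w)) :=
        fun w => by ring
      simp only [this, ← Finset.mul_sum, Finset.sum_add_distrib, Finset.sum_sub_distrib,
        hP.row_sum, escape]
    linarith

end HomogeneousWalk

end Matrix

/-! ### Averages over the vertices -/

section Avg

variable {V : Type*} [Fintype V]

theorem avg_mono {f g : V → ℝ} (h : ∀ z, f z ≤ g z) : avg f ≤ avg g :=
  div_le_div_of_nonneg_right (Finset.sum_le_sum fun z _ => h z) (Nat.cast_nonneg _)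

theorem avg_add (f g : V → ℝ) : avg (fun z => f z + g z) = avg f + avg g := by
  simp [avg, Finset.sum_add_distrib, add_div]

theorem avg_sub (f g : V → ℝ) : avg (fun z => f z - g z) = avg f - avg g := by
  simp [avg, Finset.sum_sub_distrib, sub_div]

theorem avg_const_mul (c : ℝ) (f : V → ℝ) : avg (fun z => c * f z) = c * avg f := by
  rw [avg, avg, ← Finset.mul_sum, mul_div_assoc]

theorem avg_const [Nonempty V] (c : ℝ) : avg (fun _ : V => c) = c := by
  simp [avg, mul_div_cancel_left₀]

theorem avg_nonneg {f : V → ℝ} (h : ∀ z, 0 ≤ f z) : 0 ≤ avg f :=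
  div_nonneg (Finset.sum_nonneg fun z _ => h z) (Nat.cast_nonneg _)

end Avg

/-! ### Mixing estimates and decoupling of survival probabilities -/

section Mixing

variable {V : Type*} [Fintype V]

/-- The mean absolute deviation of `survive P A t` from its average. -/
noncomputable def surviveDev (P : Matrix V V ℝ) (A : Finset V) (t : ℕ) : ℝ :=
  avg fun z => |survive P A t z - avg (survive P A t)|

/-- The `ℓ¹` distance of the law at time `k` of the walk from `z` to the uniform law. -/
noncomputable def l1Dist (P : Matrix V V ℝ) (k : ℕ) (z : V) : ℝ :=
  ∑ w, |(P ^ k) z w - 1 / Fintype.card V|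

namespace HomogeneousWalk

variable {P : Matrix V V ℝ} (hP : HomogeneousWalk P)
include hP

/-- By stationarity `escape` and `survive` at time `t` have the same average; passing to `survive`
at `t + 1` merely discards the contribution of starting points in `A`. -/
theorem avg_survive_sub_succ (A : Finset V) (t : ℕ) :
    avg (survive P A t) - avg (survive P A (t + 1)) =
      (∑ a ∈ A, escape P A t a) / Fintype.card V := by
  rw [avg, avg, ← sub_div]
  congr 1
  have h1 : ∑ z, survive P A t z = ∑ z, escape P A t z := by
    simp only [escape]
    rw [Finset.sum_comm]
    refine Finset.sum_congr rfl fun w _ => ?_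
    rw [← Finset.sum_mul, Finset.sum_congr rfl fun y _ => hP.symm y w, hP.row_sum, one_mul]
  rw [h1, ← Finset.sum_sub_distrib, ← Finset.sum_filter_add_sum_filter_not Finset.univ (· ∈ A)]
  have h2 : ∑ z ∈ Finset.univ.filter (· ∉ A), (escape P A t z - survive P A (t + 1) z) = 0 :=
    Finset.sum_eq_zero fun z hz => by
      rw [survive_succ_of_notMem t (Finset.mem_filter.1 hz).2, sub_self]
  rw [h2, add_zero, Finset.filter_univ_mem]
  exact Finset.sum_congr rfl fun z hz => by rw [survive_succ_of_mem t hz, sub_zero]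

theorem avg_survive_pair_sub_succ {x y : V} (hxy : x ≠ y) (t : ℕ) :
    avg (survive P {x, y} t) - avg (survive P {x, y} (t + 1)) =
      2 * escape P {x, y} t x / Fintype.card V := by
  rw [hP.avg_survive_sub_succ, Finset.sum_pair hxy, ← hP.escape_pair x y hxy]
  ring

theorem avg_survive_sub_add_le (A : Finset V) (t j : ℕ) :
    avg (survive P A t) - avg (survive P A (t + j)) ≤ A.card * j / Fintype.card V := by
  induction j with
  | zero => simp
  | succ j ih =>
    have h1 := hP.avg_survive_sub_succ A (t + j)
    have h2 : (∑ a ∈ A, escape P A (t + j) a) / Fintype.card V ≤ A.card / Fintype.card V := by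
      refine div_le_div_of_nonneg_right ?_ (Nat.cast_nonneg _)
      calc _ ≤ ∑ a ∈ A, (1 : ℝ) := Finset.sum_le_sum fun a _ => hP.escape_le_one A _ a
        _ = _ := by simp
    have h3 : (A.card : ℝ) * ((j + 1 : ℕ) : ℝ) / Fintype.card V =
        A.card * j / Fintype.card V + A.card / Fintype.card V := by push_cast; ring
    rw [← add_assoc, h3]
    linarith

theorem avg_survive_nonneg (A : Finset V) (t : ℕ) : 0 ≤ avg (survive P A t) :=
  avg_nonneg (hP.survive_nonneg A t)

theorem avg_survive_antitone (A : Finset V) : Antitone fun t => avg (survive P A t) :=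
  fun _ _ h => avg_mono fun z => hP.survive_antitone A z h

theorem avg_survive_le_one [Nonempty V] (A : Finset V) (t : ℕ) : avg (survive P A t) ≤ 1 :=
  (avg_mono (hP.survive_le_one A t)).trans (avg_const 1).le

theorem one_sub_avg_survive_le [Nonempty V] (A : Finset V) (t : ℕ) :
    1 - avg (survive P A t) ≤ A.card * t / Fintype.card V := by
  have h := hP.avg_survive_sub_add_le A 0 t
  have h0 : survive P A 0 = fun _ => (1 : ℝ) := funext fun z => survive_zero P A z
  rwa [h0, avg_const, zero_add] at h

variable [Nonempty V] {T : ℕ}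
  (hT : ∀ x y, |(P ^ T) x y * Fintype.card V - 1| ≤ 1 / 4)
include hT

omit hP in
theorem abs_pow_sub_le (x y : V) :
    |(P ^ T) x y - 1 / Fintype.card V| ≤ 1 / 4 / Fintype.card V := by
  have hN : (0 : ℝ) < Fintype.card V := Nat.cast_pos.2 Fintype.card_pos
  rw [le_div_iff₀ hN, ← abs_of_pos hN, ← abs_mul, abs_of_pos hN, sub_mul,
    div_mul_cancel₀ _ hN.ne']
  exact hT x y

theorem pow_le_of_ge {r : ℕ} (hr : T ≤ r) (x y : V) :
    (P ^ r) x y ≤ 5 / 4 / Fintype.card V := by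
  obtain ⟨k, rfl⟩ := Nat.exists_eq_add_of_le' hr
  rw [pow_add, Matrix.mul_apply]
  have h : ∀ w, (P ^ T) w y ≤ 5 / 4 / Fintype.card V := fun w => by
    have := (abs_le.1 (abs_pow_sub_le hT w y)).2
    have h2 : (5 / 4 / Fintype.card V : ℝ) = 1 / 4 / Fintype.card V + 1 / Fintype.card V := by ring
    linarith
  calc _ ≤ ∑ w, (P ^ k) x w * (5 / 4 / Fintype.card V) :=
        Finset.sum_le_sum fun w _ => mul_le_mul_of_nonneg_left (h w) (hP.pow_nonneg k x w)
    _ = _ := by rw [← Finset.sum_mul, hP.pow_row_sum, one_mul]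

/-- Since `P ^ T` and the uniform law have equal mass, `f` may be centred before applying the
pointwise mixing bound. -/
theorem avg_abs_pow_sub_le (f : V → ℝ) (z : V) :
    |∑ w, (P ^ T) z w * f w - avg f| ≤ 1 / 4 * avg fun w => |f w - avg f| := by
  have hN : (0 : ℝ) < Fintype.card V := Nat.cast_pos.2 Fintype.card_pos
  have h : ∑ w, (P ^ T) z w * f w - avg f =
      ∑ w, ((P ^ T) z w - 1 / Fintype.card V) * (f w - avg f) := by
    have h1 : ∀ w, ((P ^ T) z w - 1 / Fintype.card V) * (f w - avg f) =
        (P ^ T) z w * f w - (P ^ T) z w * avg f - 1 / Fintype.card V * f w +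
          1 / Fintype.card V * avg f := fun w => by ring
    simp only [h1, Finset.sum_add_distrib, Finset.sum_sub_distrib, ← Finset.sum_mul,
      ← Finset.mul_sum, hP.pow_row_sum, Finset.sum_const, Finset.card_univ, nsmul_eq_mul]
    have h2 : 1 / (Fintype.card V : ℝ) * ∑ w, f w = avg f := by rw [avg]; ring
    rw [h2]
    field_simp
    ring
  rw [h]
  refine (Finset.abs_sum_le_sum_abs _ _).trans ?_
  have h3 : 1 / 4 * avg (fun w => |f w - avg f|) =
      ∑ w, 1 / 4 / (Fintype.card V : ℝ) * |f w - avg f| := by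
    rw [← Finset.mul_sum, avg]; ring
  rw [h3]
  refine Finset.sum_le_sum fun w _ => ?_
  rw [abs_mul]
  exact mul_le_mul_of_nonneg_right (abs_pow_sub_le hT z w) (abs_nonneg _)

omit hT [Nonempty V] in
-- Ignoring `A` during the first `T` steps costs at most the probability of meeting it then.
theorem sum_pow_mul_survive_sub_le (A : Finset V) (j : ℕ) (z : V) :
    0 ≤ ∑ w, (P ^ T) z w * survive P A j w - survive P A (T + j) z ∧
      ∑ w, (P ^ T) z w * survive P A j w - survive P A (T + j) z ≤ 1 - survive P A T z := by
  rw [survive_add, ← Finset.sum_sub_distrib, ← hP.pow_row_sum T z, survive,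
    ← Finset.sum_sub_distrib]
  simp only [← sub_mul]
  exact ⟨Finset.sum_nonneg fun w _ => mul_nonneg (sub_nonneg.2 (hP.killed_pow_le A T z w))
    (hP.survive_nonneg A j w), Finset.sum_le_sum fun w _ =>
      mul_le_of_le_one_right (sub_nonneg.2 (hP.killed_pow_le A T z w)) (hP.survive_le_one A j w)⟩

/-- With `b = |A| T / N`, running `T` steps without killing gives `D_{T+k} ≤ 2b + D_k/4`, and `D_j ≤
2b` for `j < T`; the bound `3b` is preserved because `2 + 3/4 ≤ 3`. -/
theorem surviveDev_le (A : Finset V) (hT1 : 1 ≤ T) (j : ℕ) :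
    surviveDev P A j ≤ 3 * (A.card * T / Fintype.card V) := by
  set b : ℝ := A.card * T / Fintype.card V with hb
  have hb0 : 0 ≤ b := by positivity
  induction j using Nat.strong_induction_on with
  | _ j ih =>
    by_cases hj : j < T
    · have h1 : 1 - avg (survive P A j) ≤ b := by
        refine (hP.one_sub_avg_survive_le A j).trans ?_
        rw [hb]
        gcongr
      have h2 : surviveDev P A j ≤
          avg fun z => (1 - survive P A j z) + (1 - avg (survive P A j)) := by
        refine avg_mono fun z => ?_
        have e1 := hP.survive_le_one A j z
        have e2 := hP.avg_survive_le_one A j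
        rw [abs_le]; constructor <;> linarith
      rw [avg_add, avg_sub, avg_const, avg_const] at h2
      linarith
    · obtain ⟨k, rfl⟩ := Nat.exists_eq_add_of_le (not_lt.1 hj)
      have hk := ih k (by omega)
      have h1 := hP.avg_survive_sub_add_le A k T
      rw [add_comm k T, ← hb] at h1
      have h0 := hP.avg_survive_antitone A (Nat.le_add_left k T)
      have h2 := hP.one_sub_avg_survive_le A T
      rw [← hb] at h2
      have h3 : surviveDev P A (T + k) ≤ avg fun z => (1 - survive P A T z) +
          (1 / 4 * surviveDev P A k + (avg (survive P A k) - avg (survive P A (T + k)))) := by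
        refine avg_mono fun z => ?_
        have e1 := hP.sum_pow_mul_survive_sub_le (T := T) A k z
        have e2 := hP.avg_abs_pow_sub_le hT (survive P A k) z
        rw [abs_le] at e2
        simp only [surviveDev] at *
        rw [abs_le]; constructor <;> linarith
      rw [avg_add, avg_sub, avg_const, avg_const] at h3
      linarith

/-- The deviation from uniformity is multiplicative, because the uniform law is invariant on both
sides; the second factor has entries at most `1/(4N)`. -/
theorem l1Dist_add_le (k : ℕ) (z : V) : l1Dist P (k + T) z ≤ 1 / 4 * l1Dist P k z := by
  have hN : (0 : ℝ) < Fintype.card V := Nat.cast_pos.2 Fintype.card_pos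
  have h : ∀ w, (P ^ (k + T)) z w - 1 / Fintype.card V =
      ∑ v, ((P ^ k) z v - 1 / Fintype.card V) * ((P ^ T) v w - 1 / Fintype.card V) := fun w => by
    have h1 : ∀ v, ((P ^ k) z v - 1 / Fintype.card V) * ((P ^ T) v w - 1 / Fintype.card V) =
        (P ^ k) z v * (P ^ T) v w - (P ^ k) z v * (1 / Fintype.card V) -
          1 / Fintype.card V * (P ^ T) v w +
          1 / Fintype.card V * (1 / Fintype.card V) := fun v => by ring
    simp only [h1, Finset.sum_add_distrib, Finset.sum_sub_distrib, ← Finset.sum_mul,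
      ← Finset.mul_sum, hP.pow_row_sum, hP.pow_col_sum, Finset.sum_const, Finset.card_univ,
      nsmul_eq_mul, ← Matrix.mul_apply, ← pow_add]
    field_simp
    ring
  have h2 : l1Dist P (k + T) z ≤ ∑ _w : V, ∑ v,
      |(P ^ k) z v - 1 / (Fintype.card V : ℝ)| * (1 / 4 / (Fintype.card V : ℝ)) := by
    refine Finset.sum_le_sum fun w _ => ?_
    rw [h]
    refine (Finset.abs_sum_le_sum_abs _ _).trans (Finset.sum_le_sum fun v _ => ?_)
    rw [abs_mul]
    exact mul_le_mul_of_nonneg_left (abs_pow_sub_le hT v w) (abs_nonneg _)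
  refine h2.trans (le_of_eq ?_)
  simp only [← Finset.sum_mul, Finset.sum_const, Finset.card_univ, nsmul_eq_mul, l1Dist]
  field_simp

omit hT in
theorem l1Dist_le_two (k : ℕ) (z : V) : l1Dist P k z ≤ 2 := by
  have hN : (0 : ℝ) < Fintype.card V := Nat.cast_pos.2 Fintype.card_pos
  calc l1Dist P k z ≤ ∑ w, ((P ^ k) z w + 1 / Fintype.card V) := by
        refine Finset.sum_le_sum fun w _ => ?_
        have h1 := hP.pow_nonneg k z w
        have h2 : (0 : ℝ) ≤ 1 / Fintype.card V := by positivity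
        rw [abs_le]; constructor <;> linarith
    _ = 2 := by
        rw [Finset.sum_add_distrib, hP.pow_row_sum]
        simp [Finset.card_univ]
        norm_num

theorem l1Dist_le_pow (q k : ℕ) (hk : q * T ≤ k) (z : V) : l1Dist P k z ≤ 2 * (1 / 4) ^ q := by
  induction q generalizing k with
  | zero => simpa using hP.l1Dist_le_two k z
  | succ q ih =>
    obtain ⟨i, rfl⟩ := Nat.exists_eq_add_of_le' ((Nat.le_mul_of_pos_left T q.succ_pos).trans hk)
    have h1 := ih i (by rw [Nat.succ_mul] at hk; omega)
    have h2 := hP.l1Dist_add_le hT i z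
    rw [pow_succ]
    linarith

/-- The law of the surviving walk depends little on the starting point. -/
theorem abs_killed_pow_sub_avg_le (A : Finset V) {m : ℕ} (hm : T ≤ m) (z w : V) :
    |(killed P A ^ m) z w - avg fun v => (killed P A ^ m) v w| ≤
      5 / 4 / Fintype.card V * (l1Dist P (m - T) z + (1 - survive P A m z) +
        (1 - avg (survive P A m))) := by
  obtain ⟨k, rfl⟩ := Nat.exists_eq_add_of_le' hm
  rw [Nat.add_sub_cancel]
  have hN : (0 : ℝ) < Fintype.card V := Nat.cast_pos.2 Fintype.card_pos
  have h1 : (killed P A ^ (k + T)) z w - avg (fun v => (killed P A ^ (k + T)) v w) =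
      ∑ v, ((killed P A ^ k) z v - avg fun u => (killed P A ^ k) u v) * (killed P A ^ T) v w := by
    simp only [pow_add, Matrix.mul_apply, sub_mul, Finset.sum_sub_distrib, avg]
    congr 1
    rw [Finset.sum_comm, Finset.sum_div]
    exact Finset.sum_congr rfl fun v _ => by rw [← Finset.sum_mul]; ring
  -- Compare both killed laws with the uniform law; the deficits are nonnegative and sum to hitting
  -- probabilities. The last `T` steps then spread the difference with density at most `5/(4N)`.
  have h2 : ∀ v, |(killed P A ^ k) z v - avg fun u => (killed P A ^ k) u v| ≤
      |(P ^ k) z v - 1 / Fintype.card V| + ((P ^ k) z v - (killed P A ^ k) z v) +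
        (1 / Fintype.card V - avg fun u => (killed P A ^ k) u v) := fun v => by
    have e1 := hP.killed_pow_le A k z v
    have e2 : avg (fun u => (killed P A ^ k) u v) ≤ 1 / Fintype.card V := by
      rw [avg, ← hP.pow_col_sum k v]
      exact div_le_div_of_nonneg_right
        (Finset.sum_le_sum fun u _ => hP.killed_pow_le A k u v) hN.le
    have e3 := abs_le.1 (le_refl |(P ^ k) z v - 1 / (Fintype.card V : ℝ)|)
    rw [abs_le]; constructor <;> linarith
  have h3 : ∑ v, |(killed P A ^ k) z v - avg fun u => (killed P A ^ k) u v| ≤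
      l1Dist P k z + (1 - survive P A k z) + (1 - avg (survive P A k)) := by
    refine (Finset.sum_le_sum fun v _ => h2 v).trans (le_of_eq ?_)
    simp only [Finset.sum_add_distrib, Finset.sum_sub_distrib, hP.pow_row_sum, l1Dist, survive, avg,
      Finset.sum_const, Finset.card_univ, nsmul_eq_mul]
    rw [mul_one_div_cancel hN.ne', ← Finset.sum_div, Finset.sum_comm]
  have h4 := hP.survive_antitone A z (Nat.le_add_right k T)
  have h5 := hP.avg_survive_antitone A (Nat.le_add_right k T)
  simp only at h4 h5
  rw [h1]
  calc _ ≤ ∑ v, |(killed P A ^ k) z v - avg fun u => (killed P A ^ k) u v| *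
        (5 / 4 / Fintype.card V) := by
        refine (Finset.abs_sum_le_sum_abs _ _).trans (Finset.sum_le_sum fun v _ => ?_)
        rw [abs_mul, abs_of_nonneg (hP.killed_pow_nonneg A T v w)]
        exact mul_le_mul_of_nonneg_left
          ((hP.killed_pow_le A T v w).trans (hP.pow_le_of_ge hT le_rfl v w)) (abs_nonneg _)
    _ ≤ _ := by
        rw [← Finset.sum_mul, mul_comm]
        refine mul_le_mul_of_nonneg_left ?_ (by positivity)
        linarith

/-- Decoupling of the survival probability at a mixing scale. -/
theorem abs_survive_add_sub_le (A : Finset V) (hT1 : 1 ≤ T) {m : ℕ} (hm : T ≤ m) (j : ℕ) (z : V) :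
    |survive P A (m + j) z - avg (survive P A (m + j)) -
        (survive P A m z - avg (survive P A m)) * avg (survive P A j)| ≤
      15 / 4 * (l1Dist P (m - T) z + (1 - survive P A m z) + (1 - avg (survive P A m))) *
        (A.card * T / Fintype.card V) := by
  have hN : (0 : ℝ) < Fintype.card V := Nat.cast_pos.2 Fintype.card_pos
  set M := l1Dist P (m - T) z + (1 - survive P A m z) + (1 - avg (survive P A m)) with hM
  have hM0 : 0 ≤ M := by
    have h1 : 0 ≤ l1Dist P (m - T) z := Finset.sum_nonneg fun _ _ => abs_nonneg _
    linarith [hP.survive_le_one A m z, hP.avg_survive_le_one A m]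
  have h1 : ∀ j, avg (survive P A (m + j)) =
      ∑ w, (avg fun v => (killed P A ^ m) v w) * survive P A j w := fun j => by
    simp only [avg, survive_add]
    rw [Finset.sum_comm, Finset.sum_div]
    exact Finset.sum_congr rfl fun v _ => by rw [← Finset.sum_mul]; ring
  have h2 : avg (survive P A m) = ∑ w, avg fun v => (killed P A ^ m) v w := by
    simpa [survive_zero] using h1 0
  -- The centred law at time `m` has total mass `survive P A m z - avg (survive P A m)`, so centring
  -- `survive P A j` produces exactly the product term.
  have h3 : survive P A (m + j) z - avg (survive P A (m + j)) -
        (survive P A m z - avg (survive P A m)) * avg (survive P A j) =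
      ∑ w, ((killed P A ^ m) z w - avg fun v => (killed P A ^ m) v w) *
        (survive P A j w - avg (survive P A j)) := by
    have h4 : survive P A m z = ∑ w, (killed P A ^ m) z w := rfl
    rw [h1, h2, h4, survive_add, ← Finset.sum_sub_distrib, ← Finset.sum_sub_distrib,
      Finset.sum_mul, ← Finset.sum_sub_distrib]
    exact Finset.sum_congr rfl fun v _ => by ring
  rw [h3]
  calc _ ≤ ∑ w, 5 / 4 / Fintype.card V * M * |survive P A j w - avg (survive P A j)| := by
        refine (Finset.abs_sum_le_sum_abs _ _).trans (Finset.sum_le_sum fun v _ => ?_)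
        rw [abs_mul]
        exact mul_le_mul_of_nonneg_right (hP.abs_killed_pow_sub_avg_le hT A hm z v) (abs_nonneg _)
    _ = 5 / 4 * M * surviveDev P A j := by
        simp only [← Finset.mul_sum, surviveDev, avg]; ring
    _ ≤ 5 / 4 * M * (3 * (A.card * T / Fintype.card V)) :=
        mul_le_mul_of_nonneg_left (hP.surviveDev_le hT A hT1 j) (by positivity)
    _ = _ := by ring

/-- A nonempty set is eventually hit. -/
theorem tendsto_avg_survive {A : Finset V} (hA : A.Nonempty) :
    Tendsto (fun t => avg (survive P A t)) atTop (nhds 0) := by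
  have hN : (0 : ℝ) < Fintype.card V := Nat.cast_pos.2 Fintype.card_pos
  obtain ⟨a, ha⟩ := hA
  set q : ℝ := 1 - 3 / 4 / Fintype.card V with hq
  -- At time `T` the unkilled walk is at `a` with probability at least `3/(4N)`, so each block of `T
  -- + 1` steps loses a fixed proportion.
  have h1 : ∀ z, survive P A (T + 1) z ≤ q := fun z => by
    have e1 : ∀ w, (killed P A ^ T) z w * survive P A 1 w ≤
        (P ^ T) z w - if w = a then (P ^ T) z w else 0 := fun w => by
      split_ifs with h
      · rw [h, ← zero_add 1, survive_succ_of_mem 0 ha]; simp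
      · rw [sub_zero]
        exact mul_le_of_le_one_right (hP.killed_pow_nonneg A T z w) (hP.survive_le_one A 1 w)
          |>.trans (hP.killed_pow_le A T z w)
    have e2 := (abs_le.1 (abs_pow_sub_le hT z a)).1
    have e3 : (3 / 4 / Fintype.card V : ℝ) = 1 / Fintype.card V - 1 / 4 / Fintype.card V := by ring
    rw [survive_add]
    refine (Finset.sum_le_sum fun w _ => e1 w).trans ?_
    rw [Finset.sum_sub_distrib, hP.pow_row_sum, Finset.sum_ite_eq' Finset.univ a,
      if_pos (Finset.mem_univ a)]
    linarith
  have h2 : ∀ t, avg (survive P A (t + (T + 1))) ≤ q * avg (survive P A t) := fun t => by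
    rw [← avg_const_mul]
    refine avg_mono fun z => ?_
    rw [survive_add, mul_comm, survive, Finset.sum_mul]
    exact Finset.sum_le_sum fun w _ =>
      mul_le_mul_of_nonneg_left (h1 w) (hP.killed_pow_nonneg A t z w)
  have h3 := tendsto_atTop_ciInf (hP.avg_survive_antitone A)
    ⟨0, by rintro _ ⟨t, rfl⟩; exact hP.avg_survive_nonneg A t⟩
  set L := ⨅ t, avg (survive P A t)
  have h4 : L ≤ q * L := le_of_tendsto_of_tendsto'
    (h3.comp (tendsto_add_atTop_nat (T + 1))) (h3.const_mul q) h2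
  have h5 : 0 ≤ L := ge_of_tendsto' h3 (hP.avg_survive_nonneg A)
  have h6 : 0 < 3 / 4 / (Fintype.card V : ℝ) := by positivity
  have h7 : L = 0 := le_antisymm (by by_contra h; rw [not_le] at h; nlinarith) h5
  rwa [h7] at h3

end HomogeneousWalk

end Mixing

/-! ### The ratio of series weighted by escape probabilities -/

section Ratio

variable {V : Type*} [Fintype V]

namespace HomogeneousWalk

variable {P : Matrix V V ℝ} (hP : HomogeneousWalk P)
include hP

theorem avg_survive_singleton [Nonempty V] (x y : V) (t : ℕ) :
    avg (survive P {x} t) = avg (survive P {y} t) := by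
  induction t with
  | zero =>
    simp only [avg, survive_zero]
  | succ t ih =>
    have hx := hP.avg_survive_sub_succ {x} t
    have hy := hP.avg_survive_sub_succ {y} t
    rw [Finset.sum_singleton] at hx hy
    rw [hP.escape_singleton x y] at hx
    linarith

variable [Nonempty V] {x y : V} (hxy : x ≠ y)
include hxy

theorem escape_pair_eq (t : ℕ) :
    escape P {x, y} t x =
      Fintype.card V / 2 * (avg (survive P {x, y} t) - avg (survive P {x, y} (t + 1))) := by
  have hN : (0 : ℝ) < Fintype.card V := Nat.cast_pos.2 Fintype.card_pos
  rw [hP.avg_survive_pair_sub_succ hxy]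
  field_simp

theorem sum_escape_pair_le (n : ℕ) :
    ∑ t ∈ Finset.range n, escape P {x, y} t x ≤ Fintype.card V / 2 := by
  have hN : (0 : ℝ) < Fintype.card V := Nat.cast_pos.2 Fintype.card_pos
  rw [Finset.sum_congr rfl fun t _ => hP.escape_pair_eq hxy t, ← Finset.mul_sum,
    Finset.sum_range_sub' fun t => avg (survive P {x, y} t)]
  have h1 := hP.avg_survive_nonneg {x, y} n
  have h2 := hP.avg_survive_le_one {x, y} 0
  exact mul_le_of_le_one_right (by positivity) (by linarith)

theorem summable_escape_pair : Summable fun t => escape P {x, y} t x :=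
  summable_of_sum_range_le (fun t => hP.escape_nonneg _ t x) (hP.sum_escape_pair_le hxy)

theorem tsum_escape_pair_le : ∑' t, escape P {x, y} t x ≤ Fintype.card V / 2 :=
  Real.tsum_le_of_sum_range_le (fun t => hP.escape_nonneg _ t x) (hP.sum_escape_pair_le hxy)

theorem summable_escape_pair_mul {d : ℕ → ℝ} {b : ℝ} (hd : ∀ t, |d t| ≤ b) :
    Summable fun t => escape P {x, y} t x * d t := by
  refine Summable.of_norm_bounded ((hP.summable_escape_pair hxy).mul_right b) fun t => ?_
  rw [norm_mul, Real.norm_of_nonneg (hP.escape_nonneg _ t x)]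
  exact mul_le_mul_of_nonneg_left (hd t) (hP.escape_nonneg _ t x)

theorem summable_escape_pair_mul_survive (z : V) :
    Summable fun t => escape P {x, y} t x * survive P {x, y} (t + 1) z :=
  hP.summable_escape_pair_mul hxy (b := 1) fun t => by
    rw [abs_of_nonneg (hP.survive_nonneg _ _ z)]
    exact hP.survive_le_one _ _ z

theorem summable_escape_pair_mul_avg :
    Summable fun t => escape P {x, y} t x * avg (survive P {x, y} (t + 1)) :=
  hP.summable_escape_pair_mul hxy (b := 1) fun t => by
    rw [abs_of_nonneg (hP.avg_survive_nonneg _ _)]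
    exact hP.avg_survive_le_one _ _

/-- Divided by `N` the series is the probability of `H(x,y)`. With `e_t = N/2 (s_t - s_{t+1})`, one
has `e_t s_{t+1} = N/4 (s_t² - s_{t+1}²) - e_t (s_t - s_{t+1})/2`; as `e_t ≤ 1`, both parts
telescope. -/
theorem le_tsum_escape_pair_mul_avg {T : ℕ}
    (hT : ∀ x y, |(P ^ T) x y * Fintype.card V - 1| ≤ 1 / 4) :
    Fintype.card V / 4 - 1 / 2 ≤
      ∑' t, escape P {x, y} t x * avg (survive P {x, y} (t + 1)) := by
  have hN : (0 : ℝ) < Fintype.card V := Nat.cast_pos.2 Fintype.card_pos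
  set s : ℕ → ℝ := fun t => avg (survive P {x, y} t) with hs
  have h0 : s 0 = 1 := by
    have : survive P {x, y} 0 = fun _ => (1 : ℝ) := funext fun z => survive_zero P _ z
    simp only [hs, this, avg_const]
  have h1 : ∀ n, Fintype.card V / 4 * (1 - s n ^ 2) - 1 / 2 * (1 - s n) ≤
      ∑ t ∈ Finset.range n, escape P {x, y} t x * s (t + 1) := fun n => by
    induction n with
    | zero => simp [h0]
    | succ n ih =>
      rw [Finset.sum_range_succ]
      have e1 := hP.escape_pair_eq hxy n
      have e2 := hP.escape_le_one {x, y} n x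
      have e3 := hP.escape_nonneg {x, y} n x
      change _ = _ * (s n - s (n + 1)) at e1
      have e4 : escape P {x, y} n x * s (n + 1) = Fintype.card V / 4 * (s n ^ 2 - s (n + 1) ^ 2) -
          1 / 2 * (escape P {x, y} n x * (s n - s (n + 1))) := by
        rw [e1]; ring
      have e5 : 0 ≤ s n - s (n + 1) := sub_nonneg.2 (hP.avg_survive_antitone _ n.le_succ)
      have e6 : escape P {x, y} n x * (s n - s (n + 1)) ≤ s n - s (n + 1) :=
        mul_le_of_le_one_left e5 e2
      linarith
  have h2 : Tendsto (fun n => Fintype.card V / 4 * (1 - s n ^ 2) - 1 / 2 * (1 - s n)) atTop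
      (nhds ((Fintype.card V : ℝ) / 4 * (1 - 0 ^ 2) - 1 / 2 * (1 - 0))) := by
    have h := hP.tendsto_avg_survive hT (A := {x, y}) ⟨x, by simp⟩
    exact (((h.pow 2).const_sub 1).const_mul _).sub ((h.const_sub 1).const_mul _)
  have h3 := le_of_tendsto_of_tendsto' h2
    (hP.summable_escape_pair_mul_avg hxy).hasSum.tendsto_sum_nat h1
  linarith

variable {T : ℕ} (hT : ∀ x y, |(P ^ T) x y * Fintype.card V - 1| ≤ 1 / 4)
include hT

/-- For `t < m` a trivial bound suffices, as there are only `m` such times. Otherwise decoupling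
applies with `j = t + 1 - m`, and replacing `s̄_j` by `s̄_{m+j}` costs a further `2m/N`, whence `10
= 8 + 2`. -/
theorem abs_survive_succ_sub_le (hT1 : 1 ≤ T) {m : ℕ} (hm : T ≤ m) (t : ℕ) (z : V) :
    |survive P {x, y} (t + 1) z - avg (survive P {x, y} (t + 1)) -
        (survive P {x, y} m z - avg (survive P {x, y} m)) * avg (survive P {x, y} (t + 1))| ≤
      8 * T / Fintype.card V * l1Dist P (m - T) z +
        10 * m / Fintype.card V *
          ((1 - survive P {x, y} m z) + (1 - avg (survive P {x, y} m))) +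
        if t < m then 2 * ((1 - survive P {x, y} m z) + (1 - avg (survive P {x, y} m))) else 0 := by
  have hN : (0 : ℝ) < Fintype.card V := Nat.cast_pos.2 Fintype.card_pos
  set A : Finset V := {x, y} with hA
  have hcard : (A.card : ℝ) = 2 := by rw [hA, Finset.card_pair hxy]; norm_num
  set Φ := (1 - survive P A m z) + (1 - avg (survive P A m)) with hΦ
  have e1 := hP.survive_le_one A m z
  have e2 := hP.avg_survive_le_one A m
  have hΦ0 : 0 ≤ Φ := by linarith
  have hδ : 0 ≤ l1Dist P (m - T) z := Finset.sum_nonneg fun _ _ => abs_nonneg _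
  have hdev : |survive P A m z - avg (survive P A m)| ≤ Φ := by
    rw [abs_le]; constructor <;> linarith
  have hnn : 0 ≤ 8 * T / Fintype.card V * l1Dist P (m - T) z + 10 * m / Fintype.card V * Φ := by
    positivity
  have e3 := hP.avg_survive_nonneg A (t + 1)
  have e4 := hP.avg_survive_le_one A (t + 1)
  split_ifs with h
  · have e5 : survive P A m z ≤ survive P A (t + 1) z := hP.survive_antitone A z h
    have e6 : avg (survive P A m) ≤ avg (survive P A (t + 1)) := hP.avg_survive_antitone A h
    have e7 := hP.survive_le_one A (t + 1) z
    have e8 : |survive P A (t + 1) z - avg (survive P A (t + 1))| ≤ Φ := by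
      rw [abs_le]; constructor <;> linarith
    have e9 : |(survive P A m z - avg (survive P A m)) * avg (survive P A (t + 1))| ≤ Φ := by
      rw [abs_mul, abs_of_nonneg e3]
      exact (mul_le_of_le_one_right (abs_nonneg _) e4).trans hdev
    have := abs_sub (survive P A (t + 1) z - avg (survive P A (t + 1)))
      ((survive P A m z - avg (survive P A m)) * avg (survive P A (t + 1)))
    linarith
  · obtain ⟨j, hj⟩ := Nat.exists_eq_add_of_le ((not_lt.1 h).trans t.le_succ)
    rw [Nat.succ_eq_add_one] at hj
    rw [hj]
    have e5 := hP.abs_survive_add_sub_le hT A hT1 hm j z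
    have e6 := hP.avg_survive_sub_add_le A j m
    have e7 : 0 ≤ avg (survive P A j) - avg (survive P A (j + m)) :=
      sub_nonneg.2 (hP.avg_survive_antitone A (Nat.le_add_right j m))
    rw [add_comm j m, hcard] at e6
    rw [add_comm j m] at e7
    have e8 : |(survive P A m z - avg (survive P A m)) *
        (avg (survive P A j) - avg (survive P A (m + j)))| ≤
        Φ * (2 * m / Fintype.card V) := by
      rw [abs_mul, abs_of_nonneg e7]
      exact mul_le_mul hdev e6 e7 hΦ0
    have e9 := abs_add_le (survive P A (m + j) z - avg (survive P A (m + j)) -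
        (survive P A m z - avg (survive P A m)) * avg (survive P A j))
      ((survive P A m z - avg (survive P A m)) *
        (avg (survive P A j) - avg (survive P A (m + j))))
    have e10 : survive P A (m + j) z - avg (survive P A (m + j)) -
        (survive P A m z - avg (survive P A m)) * avg (survive P A j) +
        (survive P A m z - avg (survive P A m)) *
        (avg (survive P A j) - avg (survive P A (m + j))) =
        survive P A (m + j) z - avg (survive P A (m + j)) -
        (survive P A m z - avg (survive P A m)) * avg (survive P A (m + j)) := by ring
    rw [e10] at e9
    rw [add_assoc (l1Dist P (m - T) z), ← hΦ, hcard] at e5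
    have e11 : 15 / 4 * (l1Dist P (m - T) z + Φ) * (2 * T / Fintype.card V) ≤
        8 * T / Fintype.card V * l1Dist P (m - T) z + 8 * m / Fintype.card V * Φ := by
      have f1 : (T : ℝ) / Fintype.card V ≤ m / Fintype.card V := by gcongr
      have f2 : 0 ≤ (T : ℝ) / Fintype.card V := by positivity
      have f3 := mul_le_mul_of_nonneg_right f1 hΦ0
      have f4 := mul_nonneg f2 hδ
      have f5 := mul_nonneg f2 hΦ0
      have g1 : 15 / 4 * (l1Dist P (m - T) z + Φ) * (2 * T / Fintype.card V) =
        15 / 2 * (T / Fintype.card V * l1Dist P (m - T) z) +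
          15 / 2 * (T / Fintype.card V * Φ) := by ring
      have g2 : 8 * T / Fintype.card V * l1Dist P (m - T) z + 8 * m / Fintype.card V * Φ =
        8 * (T / Fintype.card V * l1Dist P (m - T) z) + 8 * (m / Fintype.card V * Φ) := by ring
      linarith
    have e12 : 10 * m / Fintype.card V * Φ =
      8 * m / Fintype.card V * Φ + Φ * (2 * m / Fintype.card V) := by ring
    linarith

/-- The termwise error is summed against weights of total at most `N/2`, each at most `1`, and
divided by a denominator of order `N`. The constants are not optimised. -/
theorem abs_ratio_sub_le (hT1 : 1 ≤ T) (hN4 : 4 ≤ Fintype.card V) {m : ℕ} (hm : T ≤ m) (z : V) :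
    |(∑' t, escape P {x, y} t x * survive P {x, y} (t + 1) z) /
        (∑' t, escape P {x, y} t x * avg (survive P {x, y} (t + 1))) - 1 -
        (survive P {x, y} m z - avg (survive P {x, y} m))| ≤
      64 * (T / Fintype.card V * l1Dist P (m - T) z) +
        96 * (m / Fintype.card V *
          ((1 - survive P {x, y} m z) + (1 - avg (survive P {x, y} m)))) := by
  have hN : (0 : ℝ) < Fintype.card V := Nat.cast_pos.2 Fintype.card_pos
  have hN4' : (4 : ℝ) ≤ Fintype.card V := by exact_mod_cast hN4
  have hD := hP.le_tsum_escape_pair_mul_avg hxy hT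
  have key := fun t => hP.abs_survive_succ_sub_le hxy hT hT1 hm t z
  have hsum := hP.summable_escape_pair_mul_survive hxy z
  have hsum' := hP.summable_escape_pair_mul_avg hxy
  have e1 := hP.survive_le_one {x, y} m z
  have e2 := hP.avg_survive_le_one {x, y} m
  set D := ∑' t, escape P {x, y} t x * avg (survive P {x, y} (t + 1)) with hDdef
  set Φ := (1 - survive P {x, y} m z) + (1 - avg (survive P {x, y} m)) with hΦ
  have hΦ0 : 0 ≤ Φ := by linarith
  set κ := survive P {x, y} m z - avg (survive P {x, y} m) with hκ
  set b := 8 * T / Fintype.card V * l1Dist P (m - T) z + 10 * m / Fintype.card V * Φ with hb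
  have hδ : 0 ≤ l1Dist P (m - T) z := Finset.sum_nonneg fun _ _ => abs_nonneg _
  have hb0 : 0 ≤ b := by positivity
  -- `N/4 - 1/2 ≥ N/8` is exactly `N ≥ 4`.
  have hD8 : (Fintype.card V : ℝ) / 8 ≤ D := by linarith
  have hD0 : 0 < D := by linarith
  have h1 : (∑' t, escape P {x, y} t x * survive P {x, y} (t + 1) z) / D - 1 - κ =
      (∑' t, escape P {x, y} t x * (survive P {x, y} (t + 1) z -
        avg (survive P {x, y} (t + 1)) - κ * avg (survive P {x, y} (t + 1)))) / D := by
    have : ∀ t, escape P {x, y} t x * (survive P {x, y} (t + 1) z -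
        avg (survive P {x, y} (t + 1)) - κ * avg (survive P {x, y} (t + 1))) =
        escape P {x, y} t x * survive P {x, y} (t + 1) z -
        (1 + κ) * (escape P {x, y} t x * avg (survive P {x, y} (t + 1))) := fun t => by ring
    simp only [this]
    rw [hsum.tsum_sub (hsum'.mul_left _), tsum_mul_left, ← hDdef]
    field_simp
    ring
  have hs1 := (hP.summable_escape_pair hxy).mul_right b
  have hs2 : Summable fun t => if t < m then 2 * Φ else 0 :=
    summable_of_ne_finset_zero (s := Finset.range m) fun t ht => by
      rw [if_neg (by simpa using ht)]
  have h2 : |∑' t, escape P {x, y} t x * (survive P {x, y} (t + 1) z -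
        avg (survive P {x, y} (t + 1)) - κ * avg (survive P {x, y} (t + 1)))| ≤
      (∑' t, escape P {x, y} t x) * b + m * (2 * Φ) := by
    have h3 : (∑' t, escape P {x, y} t x) * b + m * (2 * Φ) =
        ∑' t, (escape P {x, y} t x * b + if t < m then 2 * Φ else 0) := by
      have h4 : ∑' t, (if t < m then 2 * Φ else 0) = m * (2 * Φ) := by
        rw [tsum_eq_sum (s := Finset.range m) fun t ht => if_neg (by simpa using ht),
          Finset.sum_congr rfl fun t ht => if_pos (Finset.mem_range.1 ht)]
        simp
      rw [hs1.tsum_add hs2, tsum_mul_right, h4]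
    rw [h3, ← Real.norm_eq_abs]
    refine tsum_of_norm_bounded (hs1.add hs2).hasSum fun t => ?_
    have e3 := hP.escape_nonneg {x, y} t x
    rw [norm_mul, Real.norm_of_nonneg e3, Real.norm_eq_abs]
    refine (mul_le_mul_of_nonneg_left (key t) e3).trans ?_
    rw [mul_add]
    refine add_le_add le_rfl (mul_le_of_le_one_left ?_ (hP.escape_le_one _ t x))
    split_ifs <;> positivity
  have h4 := hP.tsum_escape_pair_le hxy
  rw [h1, abs_div, abs_of_pos hD0, div_le_iff₀ hD0]
  refine h2.trans ?_
  have h5 := mul_le_mul_of_nonneg_right h4 hb0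
  have h6 : (Fintype.card V / 2 : ℝ) * b = 4 * (T * l1Dist P (m - T) z) + 5 * (m * Φ) := by
    rw [hb]; field_simp; ring
  have h7 : (64 * (T / Fintype.card V * l1Dist P (m - T) z) + 96 * (m / Fintype.card V * Φ)) *
      (Fintype.card V / 8) = 8 * (T * l1Dist P (m - T) z) + 12 * (m * Φ) := by
    field_simp; ring
  have h8 := mul_le_mul_of_nonneg_left hD8
    (show 0 ≤ 64 * (T / Fintype.card V * l1Dist P (m - T) z) + 96 * (m / Fintype.card V * Φ) by
      positivity)
  have h9 : 0 ≤ (T : ℝ) * l1Dist P (m - T) z := by positivity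
  have h10 : 0 ≤ (m : ℝ) * Φ := by positivity
  linarith

/-- The expansion of the normalised conditional law in terms of hitting probabilities. -/
theorem abs_ratio_sub_hit_le (hT1 : 1 ≤ T) (hN4 : 4 ≤ Fintype.card V) {m : ℕ} (hm : T ≤ m)
    (z : V) :
    |(∑' t, escape P {x, y} t x * survive P {x, y} (t + 1) z) /
        (∑' t, escape P {x, y} t x * avg (survive P {x, y} (t + 1))) - 1 -
        (2 * (1 - avg (survive P {x} m)) - (1 - survive P {x} m z) - (1 - survive P {y} m z))| ≤
      64 * (T / Fintype.card V * l1Dist P (m - T) z) +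
        (96 * (m / Fintype.card V) + (1 - survive P {y} m x)) *
          ((1 - survive P {x} m z) + (1 - survive P {y} m z) +
            2 * (1 - avg (survive P {x} m))) := by
  have h := hP.abs_ratio_sub_le hxy hT hT1 hN4 hm z
  -- Inclusion–exclusion, pointwise in `z` and on average; nonnegativity of the overlap also bounds
  -- the pair's hitting probability by the sum of the two single ones.
  have h1 := hP.hit_both_nonneg x y m z
  have h2 := hP.hit_both_le x y m z le_rfl
  have h3 := avg_nonneg fun z => hP.hit_both_nonneg x y m z
  have h4 := avg_mono fun z => hP.hit_both_le x y m z le_rfl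
  rw [avg_add, avg_sub, avg_sub, avg_const] at h3 h4
  rw [avg_const_mul, avg_add, avg_sub, avg_sub, avg_const] at h4
  rw [hP.avg_survive_singleton y x] at h3 h4
  change 0 ≤ 1 - avg (survive P {x} m) - avg (survive P {x} m) + avg (survive P {x, y} m) at h3
  change 1 - avg (survive P {x} m) - avg (survive P {x} m) + avg (survive P {x, y} m) ≤
    (1 - survive P {y} m x) * (1 - avg (survive P {x} m) + (1 - avg (survive P {x} m))) at h4
  have hm0 : (0 : ℝ) ≤ m / Fintype.card V := by positivity
  have h5 : m / Fintype.card V *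
        ((1 - survive P {x, y} m z) + (1 - avg (survive P {x, y} m))) ≤
      m / Fintype.card V * ((1 - survive P {x} m z) + (1 - survive P {y} m z) +
            2 * (1 - avg (survive P {x} m))) :=
    mul_le_mul_of_nonneg_left (by linarith) hm0
  rw [abs_le] at h ⊢
  constructor <;> nlinarith
end HomogeneousWalk

end Ratio

/-! ### From path measures to powers of the killed matrix -/

section Trajectories

variable {V : Type*} [Fintype V]

theorem transition_nonneg (G : SimpleGraph V) (x y : V) : 0 ≤ transition G x y :=
  ENNReal.toReal_nonneg

theorem transition_row_sum (G : SimpleGraph V) (x : V) : ∑ y, transition G x y = 1 := by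
  simp only [transition, Matrix.of_apply]
  rw [← ENNReal.toReal_sum fun y _ => (lazyStep G x).apply_ne_top y,
    ← tsum_fintype (L := .unconditional V), (lazyStep G x).tsum_coe, ENNReal.toReal_one]

variable [MeasurableSpace V] [DiscreteMeasurableSpace V]

instance (G : SimpleGraph V) (μ : Measure V) [IsProbabilityMeasure μ] :
    IsProbabilityMeasure (walkLaw G μ) := by
  unfold walkLaw; infer_instance

theorem walkLaw_map_zero (G : SimpleGraph V) (μ : Measure V) [IsProbabilityMeasure μ] :
    (walkLaw G μ).map (fun ω => ω 0) = μ := by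
  have h : (fun ω : ℕ → V => ω 0) =
      (MeasurableEquiv.piUnique (fun _ : Finset.Iic 0 => V)) ∘ Preorder.frestrictLe 0 := rfl
  rw [h, ← Measure.map_map (by fun_prop) (by fun_prop), walkLaw, Kernel.trajMeasure,
    Measure.map_comp _ _ (by fun_prop), Kernel.traj_map_frestrictLe, Kernel.partialTraj_self,
    Measure.id_comp, Measure.map_map (by fun_prop) (by fun_prop)]
  exact Measure.map_id

/-- Markov property in the presence of an arbitrary event of the past, as needed to propagate
avoidance of `A`. -/
theorem walkLaw_step (G : SimpleGraph V) (μ : Measure V) [IsProbabilityMeasure μ] (t : ℕ)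
    (S : Set (Π _i : Finset.Iic t, V)) (v w : V) :
    (walkLaw G μ).real {ω | Preorder.frestrictLe t ω ∈ S ∧ ω t = v ∧ ω (t + 1) = w} =
      (walkLaw G μ).real {ω | Preorder.frestrictLe t ω ∈ S ∧ ω t = v} * transition G v w := by
  have hmap := Kernel.map_frestrictLe_trajMeasure_compProd_eq_map_trajMeasure
    (X := fun _ => V) (μ₀ := μ) (κ := stepKernel G) (a := t)
  set S' : Set (Π _i : Finset.Iic t, V) := {η | η ∈ S ∧ η ⟨t, Finset.mem_Iic.2 le_rfl⟩ = v}
  have hS' : MeasurableSet S' := .of_discrete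
  have h := congrArg (fun ν => ν (S' ×ˢ {w})) hmap
  beta_reduce at h
  rw [Measure.map_apply (by fun_prop) (hS'.prod (.singleton w)),
    Measure.compProd_apply_prod hS' (.singleton w)] at h
  have h1 : ∫⁻ η in S', stepKernel G t η {w}
        ∂((Kernel.trajMeasure (X := fun _ => V) μ (stepKernel G)).map (Preorder.frestrictLe t)) =
      lazyStep G v w * walkLaw G μ (Preorder.frestrictLe t ⁻¹' S') := by
    rw [setLIntegral_congr_fun (g := fun _ => lazyStep G v w) hS' fun η hη => ?_,
      setLIntegral_const, Measure.map_apply (by fun_prop) hS']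
    · rfl
    · change (lazyStep G (η ⟨t, _⟩)).toMeasure {w} = _
      rw [hη.2, PMF.toMeasure_apply_singleton _ _ (.singleton w)]
  rw [h1] at h
  have h2 : (fun ω : ℕ → V => (Preorder.frestrictLe (π := fun _ => V) t ω, ω (t + 1))) ⁻¹'
        (S' ×ˢ {w}) =
      {ω : ℕ → V | Preorder.frestrictLe t ω ∈ S ∧ ω t = v ∧ ω (t + 1) = w} := by
    ext ω
    simp [S', and_assoc]
  have h3 : Preorder.frestrictLe (π := fun _ => V) t ⁻¹' S' =
      {ω : ℕ → V | Preorder.frestrictLe t ω ∈ S ∧ ω t = v} := by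
    ext ω
    simp [S']
  rw [h2, h3] at h
  rw [measureReal_def, measureReal_def, transition, Matrix.of_apply, ← ENNReal.toReal_mul,
    mul_comm, h]
  rfl

omit [Fintype V] in
theorem measurableSet_avoid (A : Finset V) (t : ℕ) :
    MeasurableSet {ω : ℕ → V | ∀ i < t, ω i ∉ A} := by
  simp only [Set.ofPred_forall]
  refine .iInter fun i => .iInter fun _ => ?_
  change MeasurableSet ((fun ω : ℕ → V => ω i) ⁻¹' {v | v ∉ A})
  exact measurable_pi_apply i .of_discrete

omit [Fintype V] in
theorem measurableSet_coord (t : ℕ) (v : V) : MeasurableSet {ω : ℕ → V | ω t = v} := by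
  change MeasurableSet ((fun ω : ℕ → V => ω t) ⁻¹' {v})
  exact measurable_pi_apply t (.singleton v)

omit [Fintype V] in
theorem measurableSet_avoid_at (A : Finset V) (s t : ℕ) (v : V) :
    MeasurableSet {ω : ℕ → V | (∀ i < s, ω i ∉ A) ∧ ω t = v} :=
  (measurableSet_avoid A s).inter (measurableSet_coord t v)

theorem measureReal_eq_sum_coord (ν : Measure (ℕ → V)) [IsFiniteMeasure ν] (t : ℕ)
    (E : Set (ℕ → V)) : ν.real E = ∑ v, ν.real {ω | ω ∈ E ∧ ω t = v} := by
  have h := sum_measure_preimage_singleton (μ := ν.restrict E) (Finset.univ : Finset V)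
    (f := fun ω : ℕ → V => ω t) fun v _ => measurableSet_coord t v
  simp only [Finset.coe_univ, Set.preimage_univ, Measure.restrict_apply_univ] at h
  rw [measureReal_def, ← h, ENNReal.toReal_sum fun v _ => measure_ne_top _ _]
  refine Finset.sum_congr rfl fun v _ => ?_
  rw [Measure.restrict_apply (measurable_pi_apply t (.singleton v)), measureReal_def,
    Set.inter_comm]
  rfl

/-- The law of the walk on the event that it has avoided `A`. -/
theorem walkLaw_avoid (G : SimpleGraph V) (μ : Measure V) [IsProbabilityMeasure μ] (A : Finset V)
    (t : ℕ) (w : V) :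
    (walkLaw G μ).real {ω | (∀ i < t, ω i ∉ A) ∧ ω t = w} =
      ∑ z, μ.real {z} * (killed (transition G) A ^ t) z w := by
  induction t generalizing w with
  | zero =>
    have h : (walkLaw G μ).real {ω | ω 0 = w} = μ.real {w} := by
      conv_rhs => rw [← walkLaw_map_zero G μ]
      rw [map_measureReal_apply (measurable_pi_apply 0) (.singleton w)]
      rfl
    simpa [Matrix.one_apply] using h
  | succ t ih =>
    rw [measureReal_eq_sum_coord _ t]
    have h : ∀ v, (walkLaw G μ).real
          {ω | ω ∈ {ω : ℕ → V | (∀ i < t + 1, ω i ∉ A) ∧ ω (t + 1) = w} ∧ ω t = v} =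
        (walkLaw G μ).real {ω | (∀ i < t, ω i ∉ A) ∧ ω t = v} * killed (transition G) A v w := by
      intro v
      by_cases hv : v ∈ A
      · have : {ω | ω ∈ {ω : ℕ → V | (∀ i < t + 1, ω i ∉ A) ∧ ω (t + 1) = w} ∧ ω t = v} = ∅ := by
          ext ω
          simp only [Set.mem_ofPred_eq, Set.mem_empty_iff_false, iff_false]
          rintro ⟨⟨h1, -⟩, h2⟩
          exact h1 t t.lt_succ_self (h2 ▸ hv)
        rw [this]
        simp [killed, hv]
      · have h1 := walkLaw_step G μ t
          {η | ∀ i, (hi : i < t) → η ⟨i, Finset.mem_Iic.2 hi.le⟩ ∉ A} v w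
        have h2 : killed (transition G) A v w = transition G v w := by simp [killed, hv]
        rw [h2]
        refine Eq.trans ?_ h1
        congr 1
        ext ω
        simp only [Set.mem_ofPred_eq, Preorder.frestrictLe_apply, Order.lt_add_one_iff]
        constructor
        · rintro ⟨⟨h1, h3⟩, h4⟩
          exact ⟨fun i hi => h1 i hi.le, h4, h3⟩
        · rintro ⟨h1, h4, h3⟩
          refine ⟨⟨fun i hi => ?_, h3⟩, h4⟩
          rcases hi.lt_or_eq with hi | rfl
          · exact h1 i hi
          · rwa [h4]
    simp only [h, ih, pow_succ, Matrix.mul_apply, Finset.mul_sum, Finset.sum_mul]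
    rw [Finset.sum_comm]
    simp only [mul_assoc]

theorem walkLaw_survive (G : SimpleGraph V) (μ : Measure V) [IsProbabilityMeasure μ] (A : Finset V)
    (t : ℕ) :
    (walkLaw G μ).real {ω | ∀ i < t, ω i ∉ A} =
      ∑ z, μ.real {z} * survive (transition G) A t z := by
  rw [measureReal_eq_sum_coord _ t]
  have h := walkLaw_avoid G μ A t
  simp only [Set.mem_ofPred_eq]
  simp only [h, survive, Finset.mul_sum]
  exact Finset.sum_comm

omit [Fintype V] [MeasurableSpace V] [DiscreteMeasurableSpace V] in
theorem hit_eq_coe_iff (A : Set V) (ω : ℕ → V) (t : ℕ) :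
    hit A ω = t ↔ ω t ∈ A ∧ ∀ i < t, ω i ∉ A := by
  have h1 : hit A ω ≤ t ↔ ∃ j ∈ Set.Icc 0 t, ω j ∈ A := hittingAfter_le_iff
  have h2 : hit A ω < t ↔ ∃ j ∈ Set.Ico 0 t, ω j ∈ A := hittingAfter_lt_iff
  rw [le_antisymm_iff, ← not_lt (a := hit A ω), h1, h2]
  simp only [Set.mem_Icc, Set.mem_Ico, zero_le, true_and]
  constructor
  · rintro ⟨⟨j, hj, hjA⟩, h⟩
    push Not at h
    rcases hj.lt_or_eq with hj | rfl
    · exact absurd hjA (h j hj)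
    · exact ⟨hjA, h⟩
  · rintro ⟨h, h'⟩
    exact ⟨⟨t, le_rfl, h⟩, fun ⟨j, hj, hjA⟩ => h' j hj hjA⟩

omit [Fintype V] [MeasurableSpace V] [DiscreteMeasurableSpace V] in
theorem lt_hit_iff (A : Set V) (ω : ℕ → V) (t : ℕ) :
    (t : WithTop ℕ) < hit A ω ↔ ∀ i ≤ t, ω i ∉ A := by
  have h1 : hit A ω ≤ t ↔ ∃ j ∈ Set.Icc 0 t, ω j ∈ A := hittingAfter_le_iff
  rw [← not_le, h1]
  simp

/-- For natural `i`, `i < c T_mix` is the same as `i < ⌈c T_mix⌉₊`, so the real horizon becomes an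
integer one without loss. -/
theorem hitProb_eq (G : SimpleGraph V) (c : ℝ) (x y : V) :
    hitProb G c x y = 1 - survive (transition G) {y} ⌈c * Tmix G⌉₊ x := by
  have h1 : {ω | ∃ t : ℕ, hit {y} ω = t ∧ (t : ℝ) < c * Tmix G} =
      {ω : ℕ → V | ∀ i < ⌈c * Tmix G⌉₊, ω i ∉ ({y} : Finset V)}ᶜ := by
    ext ω
    simp only [Set.mem_ofPred_eq, Set.mem_compl_iff, not_forall, not_not, Finset.mem_singleton,
      Nat.lt_ceil, hit_eq_coe_iff, Set.mem_singleton_iff, exists_prop]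
    constructor
    · rintro ⟨t, ⟨h1, -⟩, h2⟩
      exact ⟨t, h2, h1⟩
    · rintro ⟨t, h2, h1⟩
      have hex : ∃ t, ω t = y := ⟨t, h1⟩
      refine ⟨Nat.find hex, ⟨Nat.find_spec hex, fun i hi => Nat.find_min hex hi⟩,
        lt_of_le_of_lt (Nat.cast_le.2 (Nat.find_min' hex h1)) h2⟩
  rw [hitProb, h1, walkFrom, probReal_compl_eq_one_sub (measurableSet_avoid _ _), walkLaw_survive]
  congr 1
  rw [Finset.sum_eq_single x]
  · simp [measureReal_def]
  · intro z _ hz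
    simp [measureReal_def, hz.symm]
  · simp

end Trajectories

/-! ### Two independent stationary walks and the conditional law -/

section Pair

variable {V : Type*} [Fintype V] [MeasurableSpace V] [DiscreteMeasurableSpace V] [Nonempty V]

omit [Nonempty V] in
theorem uniformOn_real_singleton (z : V) :
    (uniformOn (Set.univ : Set V)).real {z} = 1 / Fintype.card V := by
  simp [measureReal_def, uniformOn_univ]

instance : IsProbabilityMeasure (uniformOn (Set.univ : Set V)) :=
  isProbabilityMeasure_uniformOn Set.finite_univ Set.univ_nonempty

instance (G : SimpleGraph V) : IsProbabilityMeasure (pairLaw G) := by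
  unfold pairLaw; infer_instance

variable (G : SimpleGraph V) (hP : HomogeneousWalk (transition G)) {x y : V} (hxy : x ≠ y)

include hP in
theorem walkLaw_unif_avoid (A : Finset V) (t : ℕ) (w : V) :
    (walkLaw G (uniformOn Set.univ)).real {ω | (∀ i < t, ω i ∉ A) ∧ ω t = w} =
      escape (transition G) A t w / Fintype.card V := by
  rw [walkLaw_avoid]
  simp only [uniformOn_real_singleton, ← Finset.mul_sum]
  rw [hP.sum_killed_pow]
  ring

theorem walkLaw_unif_survive (A : Finset V) (t : ℕ) :
    (walkLaw G (uniformOn Set.univ)).real {ω | ∀ i < t, ω i ∉ A} =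
      avg (survive (transition G) A t) := by
  rw [walkLaw_survive]
  simp only [uniformOn_real_singleton, ← Finset.mul_sum]
  rw [avg]
  ring

include hP in
-- Avoidance here includes time `t` itself, which forces `z ∉ A`; this is why `survive` at `t + 1`
-- replaces `escape` at `t`.
theorem walkLaw_unif_survive_at (A : Finset V) (t : ℕ) (z : V) :
    (walkLaw G (uniformOn Set.univ)).real {ω | (∀ i < t + 1, ω i ∉ A) ∧ ω t = z} =
      survive (transition G) A (t + 1) z / Fintype.card V := by
  by_cases hz : z ∈ A
  · have : {ω : ℕ → V | (∀ i < t + 1, ω i ∉ A) ∧ ω t = z} = ∅ := by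
      ext ω
      simp only [Set.mem_ofPred_eq, Set.mem_empty_iff_false, iff_false]
      rintro ⟨h1, h2⟩
      exact h1 t t.lt_succ_self (h2 ▸ hz)
    rw [this, survive_succ_of_mem t hz]
    simp
  · rw [survive_succ_of_notMem t hz, ← walkLaw_unif_avoid G hP]
    congr 1
    ext ω
    simp only [Set.mem_ofPred_eq, Order.lt_add_one_iff]
    constructor
    · rintro ⟨h1, h2⟩
      exact ⟨fun i hi => h1 i hi.le, h2⟩
    · rintro ⟨h1, h2⟩
      refine ⟨fun i hi => ?_, h2⟩
      rcases hi.lt_or_eq with hi | rfl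
      · exact h1 i hi
      · rwa [h2]

/-- Disintegration of the event that the first walk hits `{x, y}` first, at `x`, along the time at
which this happens. -/
theorem pairLaw_real_eq_tsum (x y : V) (F : ℕ → Set (ℕ → V)) (hF : ∀ t, MeasurableSet (F t)) :
    (pairLaw G).real (⋃ t : ℕ, {ω | (∀ i < t, ω i ∉ ({x, y} : Finset V)) ∧ ω t = x} ×ˢ F t) =
      ∑' t : ℕ, (walkLaw G (uniformOn Set.univ)).real
        {ω | (∀ i < t, ω i ∉ ({x, y} : Finset V)) ∧ ω t = x} *
          (walkLaw G (uniformOn Set.univ)).real (F t) := by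
  rw [measureReal_def, measure_iUnion, ENNReal.tsum_toReal_eq fun t => measure_ne_top (pairLaw G) _]
  · simp only [pairLaw, Measure.prod_prod, ENNReal.toReal_mul, measureReal_def]
  · intro s t hst
    rw [Function.onFun, Set.disjoint_left]
    rintro ω ⟨⟨h1, h2⟩, -⟩ ⟨⟨h3, h4⟩, -⟩
    rcases lt_or_gt_of_ne hst with h | h
    · exact h3 s h (by rw [h2]; simp)
    · exact h1 t h (by rw [h4]; simp)
  · exact fun t => (measurableSet_avoid_at _ t t x).prod (hF t)

omit [Fintype V] [MeasurableSpace V] [DiscreteMeasurableSpace V] [Nonempty V] in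
include hxy in
-- The strict inequality makes the second walk avoid the pair through time `t` inclusive, while the
-- first avoids it only before `t`.
theorem eventH_eq : eventH x y =
    ⋃ t : ℕ, {ω : ℕ → V | (∀ i < t, ω i ∉ ({x, y} : Finset V)) ∧ ω t = x} ×ˢ
      {ω : ℕ → V | ∀ i < t + 1, ω i ∉ ({x, y} : Finset V)} := by
  ext ω
  simp only [eventH, Set.mem_ofPred_eq, Set.mem_iUnion, Set.mem_prod]
  constructor
  · rintro ⟨h1, h2⟩
    obtain ⟨t, ht⟩ := WithTop.ne_top_iff_exists.1 h1.ne_top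
    rw [← ht] at h1 h2
    have h3 := (hit_eq_coe_iff {x} ω.1 t).1 ht.symm
    have h4 := (lt_hit_iff {y} ω.1 t).1 h1
    have h5 := (lt_hit_iff {x, y} ω.2 t).1 h2
    refine ⟨t, ⟨fun i hi => ?_, h3.1⟩, fun i hi => ?_⟩
    · have e1 := h3.2 i hi
      have e2 := h4 i hi.le
      simp_all
    · have e1 := h5 i (Nat.le_of_lt_succ hi)
      simp_all
  · rintro ⟨t, ⟨h1, h2⟩, h3⟩
    have h4 : hit {x} ω.1 = t := (hit_eq_coe_iff {x} ω.1 t).2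
      ⟨h2, fun i hi h => h1 i hi (by rw [Set.mem_singleton_iff.1 h]; simp)⟩
    rw [h4, lt_hit_iff, lt_hit_iff]
    refine ⟨fun i hi h => ?_, fun i hi h => h3 i (Nat.lt_succ_of_le hi) (by simpa using h)⟩
    rw [Set.mem_singleton_iff] at h
    rcases hi.lt_or_eq with hi | rfl
    · exact h1 i hi (by rw [h]; simp)
    · exact hxy (h2.symm.trans h)

omit [Fintype V] [MeasurableSpace V] [DiscreteMeasurableSpace V] [Nonempty V] in
include hxy in
theorem eventH_inter_eq (z : V) :
    eventH x y ∩ {ω | ∃ t : ℕ, hit {x, y} ω.1 = t ∧ ω.2 t = z} =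
    ⋃ t : ℕ, {ω : ℕ → V | (∀ i < t, ω i ∉ ({x, y} : Finset V)) ∧ ω t = x} ×ˢ
      {ω : ℕ → V | (∀ i < t + 1, ω i ∉ ({x, y} : Finset V)) ∧ ω t = z} := by
  rw [eventH_eq hxy, Set.iUnion_inter]
  refine Set.iUnion_congr fun t => ?_
  ext ω
  simp only [Set.mem_inter_iff, Set.mem_prod, Set.mem_ofPred_eq]
  have h : (∀ i < t, ω.1 i ∉ ({x, y} : Finset V)) ∧ ω.1 t = x → hit {x, y} ω.1 = t := by
    rintro ⟨h1, h2⟩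
    refine (hit_eq_coe_iff _ _ t).2 ⟨by simp [h2], fun i hi h => h1 i hi (by simpa using h)⟩
  constructor
  · rintro ⟨⟨h1, h2⟩, s, h3, h4⟩
    rw [h h1] at h3
    obtain rfl : t = s := WithTop.coe_injective h3
    exact ⟨h1, h2, h4⟩
  · rintro ⟨h1, h2, h4⟩
    exact ⟨⟨h1, h2⟩, t, h h1, h4⟩

include hP hxy in
-- The numerator carries a factor `1/N²` from two pinned positions and the denominator `1/N`; the
-- remaining `1/N` is `π(z)`.
theorem condLaw_div_unif (z : V) :
    condLaw G x y z / unif z =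
      (∑' t, escape (transition G) {x, y} t x * survive (transition G) {x, y} (t + 1) z) /
        ∑' t, escape (transition G) {x, y} t x * avg (survive (transition G) {x, y} (t + 1)) := by
  have hN : (0 : ℝ) < Fintype.card V := Nat.cast_pos.2 Fintype.card_pos
  have hm : MeasurableSet (eventH x y) := by
    rw [eventH_eq hxy]
    exact .iUnion fun t => (measurableSet_avoid_at _ t t x).prod
      (measurableSet_avoid _ (t + 1))
  rw [condLaw, measureReal_def, cond_apply hm, ENNReal.toReal_mul, ENNReal.toReal_inv,
    ← measureReal_def, ← measureReal_def, eventH_inter_eq hxy, eventH_eq hxy,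
    pairLaw_real_eq_tsum G x y _ fun t => measurableSet_avoid _ (t + 1),
    pairLaw_real_eq_tsum G x y _ fun t => measurableSet_avoid_at _ (t + 1) t z]
  simp only [walkLaw_unif_avoid G hP, walkLaw_unif_survive, walkLaw_unif_survive_at G hP]
  have e1 : ∀ t, escape (transition G) {x, y} t x / Fintype.card V *
      (survive (transition G) {x, y} (t + 1) z / Fintype.card V) =
      escape (transition G) {x, y} t x * survive (transition G) {x, y} (t + 1) z *
        (1 / (Fintype.card V : ℝ) ^ 2) := fun t => by field_simp
  have e2 : ∀ t, escape (transition G) {x, y} t x / Fintype.card V *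
      avg (survive (transition G) {x, y} (t + 1)) =
      escape (transition G) {x, y} t x * avg (survive (transition G) {x, y} (t + 1)) *
        (1 / (Fintype.card V : ℝ)) := fun t => by field_simp
  simp only [e1, e2, tsum_mul_right, unif]
  field_simp

end Pair

/-! ### Consequences of vertex transitivity -/

section Transitive

variable {V : Type*} [Fintype V]

theorem transition_apply_of_isolated (G : SimpleGraph V) (x y : V)
    (h : ¬ (Finset.univ.filter fun y => G.Adj x y).Nonempty) :
    transition G x y = if x = y then 1 else 0 := by
  simp only [transition, lazyStep, h, dif_neg, not_false_eq_true, Matrix.of_apply, PMF.pure_apply]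
  by_cases hxy : x = y
  · simp [hxy]
  · simp [hxy, Ne.symm hxy]

theorem card_neighbors_map (G : SimpleGraph V) (φ : G ≃g G) (x : V) :
    (Finset.univ.filter fun y => G.Adj (φ x) y).card =
      (Finset.univ.filter fun y => G.Adj x y).card :=
  (Finset.card_bijective φ φ.bijective fun y => by simp [φ.map_adj_iff]).symm

theorem transition_map (G : SimpleGraph V) (φ : G ≃g G) (x y : V) :
    transition G (φ x) (φ y) = transition G x y := by
  have hc := card_neighbors_map G φ x
  by_cases h : (Finset.univ.filter fun y => G.Adj x y).Nonempty
  · have h' : (Finset.univ.filter fun y => G.Adj (φ x) y).Nonempty := by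
      rwa [← Finset.card_pos, hc, Finset.card_pos]
    rw [transition_apply G _ _ h, transition_apply G _ _ h', hc]
    simp only [φ.injective.eq_iff, φ.map_adj_iff]
  · have h' : ¬ (Finset.univ.filter fun y => G.Adj (φ x) y).Nonempty := by
      rwa [← Finset.card_pos, hc, Finset.card_pos]
    rw [transition_apply_of_isolated G _ _ h, transition_apply_of_isolated G _ _ h']
    simp only [φ.injective.eq_iff]

theorem transition_pow_map (G : SimpleGraph V) (φ : G ≃g G) (r : ℕ) (x y : V) :
    (transition G ^ r) (φ x) (φ y) = (transition G ^ r) x y := by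
  induction r generalizing y with
  | zero => simp [Matrix.one_apply, φ.injective.eq_iff]
  | succ r ih =>
    rw [pow_succ, Matrix.mul_apply, Matrix.mul_apply, ← Equiv.sum_comp φ.toEquiv]
    refine Finset.sum_congr rfl fun w _ => ?_
    change (transition G ^ r) (φ x) (φ w) * transition G (φ w) (φ y) = _
    rw [ih, transition_map]

/-- Equal degrees give symmetry, and automorphism invariance gives equal return probabilities. -/
theorem VertexTransitive.homogeneousWalk {G : SimpleGraph V} (hG : VertexTransitive G) :
    HomogeneousWalk (transition G) where
  nonneg := transition_nonneg G
  row_sum := transition_row_sum G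
  symm x y := by
    have hc : (Finset.univ.filter fun z => G.Adj x z).card =
        (Finset.univ.filter fun z => G.Adj y z).card := by
      obtain ⟨φ, rfl⟩ := hG x y
      exact (card_neighbors_map G φ x).symm
    by_cases h : (Finset.univ.filter fun z => G.Adj x z).Nonempty
    · have h' : (Finset.univ.filter fun z => G.Adj y z).Nonempty := by
        rwa [← Finset.card_pos, ← hc, Finset.card_pos]
      rw [transition_apply G _ _ h, transition_apply G _ _ h', hc]
      simp only [eq_comm (a := x), G.adj_comm x]
    · have h' : ¬ (Finset.univ.filter fun z => G.Adj y z).Nonempty := by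
        rwa [← Finset.card_pos, ← hc, Finset.card_pos]
      rw [transition_apply_of_isolated G _ _ h, transition_apply_of_isolated G _ _ h']
      simp only [eq_comm (a := x)]
  diag r x y := by
    obtain ⟨φ, rfl⟩ := hG x y
    exact (transition_pow_map G φ r x x).symm

theorem Tmix_spec {G : SimpleGraph V} (hT : 1 ≤ Tmix G) (x y : V) :
    |(transition G ^ Tmix G) x y * Fintype.card V - 1| ≤ 1 / 4 := by
  -- As `sInf ∅ = 0`, positivity of `Tmix` shows that the defining set is nonempty.
  have h := Nat.sInf_mem (Nat.nonempty_of_pos_sInf (Nat.lt_of_lt_of_le one_pos hT)) x y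
  rw [unif, div_div_eq_mul_div, div_one] at h
  exact h

theorem green_nonneg {G : SimpleGraph V} (hP : HomogeneousWalk (transition G)) (x y : V) :
    0 ≤ green G x y :=
  Finset.sum_nonneg fun t _ => hP.pow_nonneg t x y

theorem Upsilon_nonneg (G : SimpleGraph V) : 0 ≤ Upsilon G := by
  unfold Upsilon; positivity

end Transitive

/-! ### Explicit bounds at the time scale `c T_mix` -/

section Estimates

variable {V : Type*} [Fintype V] [MeasurableSpace V] [DiscreteMeasurableSpace V]
  {G : SimpleGraph V} (hP : HomogeneousWalk (transition G))

omit [MeasurableSpace V] [DiscreteMeasurableSpace V] in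
theorem ceil_mul_Tmix_div_le {c : ℝ} (hc : 2 ≤ c) (hT : 1 ≤ Tmix G) :
    (⌈c * Tmix G⌉₊ : ℝ) / Fintype.card V ≤ 2 * (c * Upsilon G) := by
  have h1 : (1 : ℝ) ≤ Tmix G := by exact_mod_cast hT
  have h2 : (⌈c * Tmix G⌉₊ : ℝ) < c * Tmix G + 1 := Nat.ceil_lt_add_one (by positivity)
  have h3 : (⌈c * Tmix G⌉₊ : ℝ) ≤ 2 * (c * Tmix G) := by nlinarith
  calc _ ≤ 2 * (c * Tmix G) / Fintype.card V := by gcongr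
    _ = _ := by rw [Upsilon]; ring

include hP

theorem hitProb_nonneg (c : ℝ) (x y : V) : 0 ≤ hitProb G c x y := by
  rw [hitProb_eq]
  exact sub_nonneg.2 (hP.survive_le_one _ _ _)

theorem hitProb_le_one (c : ℝ) (x y : V) : hitProb G c x y ≤ 1 := by
  rw [hitProb_eq]
  exact sub_le_self _ (hP.survive_nonneg _ _ _)

theorem hitProb_eq' (c : ℝ) (x y : V) :
    hitProb G c x y = 1 - survive (transition G) {x} ⌈c * Tmix G⌉₊ y := by
  rw [hitProb_eq, hP.survive_singleton_comm]

variable [Nonempty V]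

theorem hitProbMean_eq (c : ℝ) (x : V) :
    hitProbMean G c x = 1 - avg (survive (transition G) {x} ⌈c * Tmix G⌉₊) := by
  simp only [hitProbMean, hitProb_eq' hP, unif]
  rw [← avg_const (V := V) (1 : ℝ), ← avg_sub, ← Finset.sum_mul, avg_const, avg]
  ring

theorem hitProbMean_nonneg (c : ℝ) (x : V) : 0 ≤ hitProbMean G c x := by
  rw [hitProbMean_eq hP]
  exact sub_nonneg.2 (hP.avg_survive_le_one _ _)

theorem hitProbMean_le {c : ℝ} (hc : 2 ≤ c) (hT : 1 ≤ Tmix G) (x : V) :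
    hitProbMean G c x ≤ 2 * (c * Upsilon G) := by
  rw [hitProbMean_eq hP]
  refine (hP.one_sub_avg_survive_le _ _).trans ?_
  simpa using ceil_mul_Tmix_div_le hc hT

/-- Visits up to `T_mix` are counted by the Green's function; each of the at most `2cT_mix` terms of
the sum contributes at most `5/(4N)` beyond that. -/
theorem hitProb_le {c : ℝ} (hc : 2 ≤ c) (hT : 1 ≤ Tmix G) (x y : V) :
    hitProb G c x y ≤ green G x y + 5 / 2 * (c * Upsilon G) := by
  have h1 : ∀ r, (transition G ^ r) x y ≤
      (if r ∈ Finset.range (Tmix G + 1) then (transition G ^ r) x y else 0) +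
        5 / 4 / Fintype.card V := fun r => by
    split_ifs with hr
    · exact le_add_of_nonneg_right (by positivity)
    · rw [zero_add]
      exact hP.pow_le_of_ge (Tmix_spec hT) (by rw [Finset.mem_range] at hr; omega) x y
  have h2 : ∑ r ∈ Finset.range ⌈c * Tmix G⌉₊,
      (if r ∈ Finset.range (Tmix G + 1) then (transition G ^ r) x y else 0) ≤ green G x y := by
    rw [Finset.sum_ite_mem]
    exact Finset.sum_le_sum_of_subset_of_nonneg Finset.inter_subset_right
      fun r _ _ => hP.pow_nonneg r x y
  rw [hitProb_eq]
  refine (hP.one_sub_survive_singleton_le x y _).trans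
    ((Finset.sum_le_sum fun r _ => h1 r).trans ?_)
  rw [Finset.sum_add_distrib, Finset.sum_const, Finset.card_range, nsmul_eq_mul]
  have h3 := ceil_mul_Tmix_div_le (V := V) hc hT
  have h4 : (⌈c * Tmix G⌉₊ : ℝ) * (5 / 4 / Fintype.card V) =
    5 / 4 * (⌈c * Tmix G⌉₊ / Fintype.card V) := by ring
  linarith

omit [MeasurableSpace V] [DiscreteMeasurableSpace V] in
-- With `q = ⌊c⌋ - 1`, `q` mixing periods fit into the available time. Then `1/4 ≤ e⁻¹` and `q > c -
-- 2` give decay at rate `γ = 1`.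
theorem l1Dist_ceil_le {c : ℝ} (hc : 2 ≤ c) (hT : 1 ≤ Tmix G) (z : V) :
    l1Dist (transition G) (⌈c * Tmix G⌉₊ - Tmix G) z ≤ 2 * Real.exp 2 * Real.exp (-1 * c) := by
  obtain ⟨q, hq⟩ : ∃ q, ⌊c⌋₊ = q + 1 :=
    Nat.exists_eq_add_of_le' (Nat.le_floor (by push_cast; linarith))
  have h1 : (q + 1) * Tmix G ≤ ⌈c * Tmix G⌉₊ := by
    have h2 : (((q + 1) * Tmix G : ℕ) : ℝ) ≤ ⌈c * Tmix G⌉₊ := by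
      rw [← hq, Nat.cast_mul]
      exact (mul_le_mul_of_nonneg_right (Nat.floor_le (by linarith)) (Nat.cast_nonneg _)).trans
        (Nat.le_ceil _)
    exact_mod_cast h2
  have h3 := hP.l1Dist_le_pow (Tmix_spec hT) q (⌈c * Tmix G⌉₊ - Tmix G)
    (by rw [Nat.succ_mul] at h1; omega) z
  have h4 : (1 / 4 : ℝ) ≤ Real.exp (-1) := by
    rw [Real.exp_neg, one_div]
    exact inv_anti₀ (Real.exp_pos 1) (by linarith [Real.exp_one_lt_d9])
  have h5 : (1 / 4 : ℝ) ^ q ≤ Real.exp 2 * Real.exp (-1 * c) := by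
    refine (pow_le_pow_left₀ (by norm_num) h4 q).trans ?_
    rw [← Real.exp_nat_mul, ← Real.exp_add, Real.exp_le_exp]
    have h6 := Nat.lt_floor_add_one c
    rw [hq] at h6
    push_cast at h6
    linarith
  linarith

/-- The non-asymptotic estimate behind both asymptotic claims. -/
theorem condLaw_estimate {c : ℝ} (hc : 2 ≤ c) (hT : 1 ≤ Tmix G) (hN : 4 ≤ Fintype.card V)
    {x y : V} (hxy : x ≠ y) (z : V) :
    |condLaw G x y z / unif z -
        (1 + (2 * hitProbMean G c x - hitProb G c x z - hitProb G c y z))| ≤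
      128 * Real.exp 2 * (Real.exp (-1 * c) * Upsilon G) +
        (192 * (c * Upsilon G) + hitProb G c x y) *
          (hitProb G c x z + hitProb G c y z + 2 * hitProbMean G c x) := by
  have h1T : Tmix G ≤ ⌈c * Tmix G⌉₊ := by
    have h : (Tmix G : ℝ) ≤ ⌈c * Tmix G⌉₊ :=
      (le_mul_of_one_le_left (Nat.cast_nonneg _) (by linarith)).trans (Nat.le_ceil _)
    exact_mod_cast h
  have h := hP.abs_ratio_sub_hit_le hxy (Tmix_spec hT) hT hN h1T z
  rw [← condLaw_div_unif G hP hxy, ← hitProbMean_eq hP, ← hitProb_eq' hP, ← hitProb_eq' hP,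
    ← hitProb_eq, sub_sub] at h
  refine h.trans (add_le_add ?_ (mul_le_mul_of_nonneg_right ?_ ?_))
  · have h2 := mul_le_mul_of_nonneg_left (l1Dist_ceil_le hP hc hT z) (Upsilon_nonneg G)
    rw [← Upsilon]
    linarith
  · linarith [ceil_mul_Tmix_div_le (V := V) hc hT]
  · linarith [hitProb_nonneg hP c x z, hitProb_nonneg hP c y z, hitProbMean_nonneg hP c x]

end Estimates

/-- Truncating `r` to `[-a, a]` distributes one remainder over two error terms. -/
theorem exists_add_eq_of_abs_le_add {r a b : ℝ} (ha : 0 ≤ a) (hb : 0 ≤ b) (h : |r| ≤ a + b) :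
    ∃ s t : ℝ, |s| ≤ a ∧ |t| ≤ b ∧ r = s + t := by
  have h' := abs_le.1 h
  rcases le_total r (-a) with h1 | h1
  · exact ⟨-a, r + a, by rw [abs_neg, abs_of_nonneg ha], by rw [abs_le]; constructor <;> linarith,
      by ring⟩
  rcases le_total r a with h2 | h2
  · exact ⟨r, 0, abs_le.2 ⟨h1, h2⟩, by simpa using hb, by ring⟩
  · exact ⟨a, r - a, by rw [abs_of_nonneg ha], by rw [abs_le]; constructor <;> linarith, by ring⟩

end CompetingWalks

/-! ### Asymptotic conclusion -/

theorem theorem4p1 {V : ℕ → Type*} [∀ n, Fintype (V n)] [∀ n, MeasurableSpace (V n)]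
    [∀ n, DiscreteMeasurableSpace (V n)] (G : ∀ n, SimpleGraph (V n))
    (hG : StandingAssumption G) :
    (∃ γ : ℝ, 0 < γ ∧ ∃ C : ℝ, 0 < C ∧ ∀ c : ℝ, 2 ≤ c → ∀ᶠ n in atTop,
      ∀ x y z : V n, x ≠ y → ∃ ε₁ ε₂ ε₃ : ℝ,
        |ε₁| ≤ C * Delta (G n) ∧
        |ε₂| ≤ C * (Real.exp (-γ * c) * Upsilon (G n)) ∧
        |ε₃| ≤ C * ((green (G n) x z + green (G n) y z + Delta (G n)) *
          (green (G n) x y + Delta (G n))) ∧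
        condLaw (G n) x y z / unif z =
          1 + (1 + ε₁) * (2 * hitProbMean (G n) c x - hitProb (G n) c x z - hitProb (G n) c y z)
            + ε₂ + ε₃) ∧
    (∃ C : ℝ, 0 < C ∧ ∀ᶠ n in atTop, ∀ x y z : V n, x ≠ y →
      |condLaw (G n) x y z / unif z - 1| ≤
        C * (green (G n) x y + green (G n) y z + green (G n) x z + Upsilon (G n))) := by
  have hT := hG.mix_tendsto.eventually_ge_atTop 1
  have hN := hG.card_tendsto.eventually_ge_atTop 4
  have hlog : Tendsto (fun n => Real.log (Fintype.card (V n))) atTop atTop :=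
    Real.tendsto_log_atTop.comp (tendsto_natCast_atTop_atTop.comp hG.card_tendsto)
  refine ⟨⟨1, one_pos, 128 * Real.exp 2 + 1800, by positivity, fun c hc => ?_⟩,
    8000, by norm_num, ?_⟩
  · filter_upwards [hT, hN, hlog.eventually_ge_atTop c] with n hTn hNn hcn x y z hxy
    have hP := (hG.transitive n).homogeneousWalk
    have : Nonempty (V n) := ⟨x⟩
    have hU := Upsilon_nonneg (G n)
    -- Here `n` must be large depending on `c`; this absorbs the factor `c` and keeps the constants
    -- independent of it.
    have hD : c * Upsilon (G n) ≤ Delta (G n) := by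
      rw [Delta, mul_comm]; exact mul_le_mul_of_nonneg_left hcn hU
    have hU' : 0 ≤ c * Upsilon (G n) := mul_nonneg (by linarith) hU
    have hE : 0 ≤ Real.exp (-1 * c) * Upsilon (G n) := by positivity
    have hx := green_nonneg hP x z
    have hy := green_nonneg hP y z
    have hg := green_nonneg hP x y
    have e2 := Real.exp_pos 2
    -- `192 + 5/2 ≤ 200`, and `9 = 5/2 + 5/2 + 4`; the product `1800` is the constant chosen above.
    have hX : (192 * (c * Upsilon (G n)) + hitProb (G n) c x y) *
          (hitProb (G n) c x z + hitProb (G n) c y z + 2 * hitProbMean (G n) c x) ≤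
        (200 * (green (G n) x y + Delta (G n))) *
          (9 * (green (G n) x z + green (G n) y z + Delta (G n))) := by
      refine mul_le_mul ?_ ?_ ?_ (by linarith)
      · linarith [hitProb_le hP hc hTn x y]
      · linarith [hitProb_le hP hc hTn x z, hitProb_le hP hc hTn y z, hitProbMean_le hP hc hTn x]
      · linarith [hitProb_nonneg hP c x z, hitProb_nonneg hP c y z, hitProbMean_nonneg hP c x]
    have hX0 : 0 ≤ (green (G n) x z + green (G n) y z + Delta (G n)) *
        (green (G n) x y + Delta (G n)) := mul_nonneg (by linarith) (by linarith)
    obtain ⟨s, t, hs, ht, hst⟩ := exists_add_eq_of_abs_le_add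
      (a := (128 * Real.exp 2 + 1800) * (Real.exp (-1 * c) * Upsilon (G n)))
      (b := (128 * Real.exp 2 + 1800) * ((green (G n) x z + green (G n) y z + Delta (G n)) *
        (green (G n) x y + Delta (G n))))
      (by positivity) (mul_nonneg (by positivity) hX0)
      ((condLaw_estimate hP hc hTn hNn hxy z).trans (by nlinarith [mul_nonneg e2.le hX0]))
    -- No relative correction of the main term is needed: the whole remainder fits into `ε₂` and
    -- `ε₃`.
    exact ⟨0, s, t, by rw [abs_zero]; exact mul_nonneg (by positivity) (hU'.trans hD), hs, ht,
      by linarith⟩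
  · have hmix := hG.mix_small.bound one_pos
    filter_upwards [hT, hN, hlog.eventually_ge_atTop 1, hmix] with n hTn hNn hln hmn x y z hxy
    have hP := (hG.transitive n).homogeneousWalk
    have : Nonempty (V n) := ⟨x⟩
    have hU := Upsilon_nonneg (G n)
    -- Now `c = 2`. With `Υ ≤ 1` the first factor of the product error is at most `384 + 1`, so
    -- everything becomes linear in the Green's functions and `Υ`.
    have hU1 : Upsilon (G n) ≤ 1 := by
      have hN0 : (0 : ℝ) < Fintype.card (V n) := Nat.cast_pos.2 Fintype.card_pos
      rw [Upsilon, div_le_one hN0]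
      rw [one_mul, Real.norm_of_nonneg (by positivity), Real.norm_of_nonneg (by positivity)] at hmn
      exact hmn.trans (div_le_self hN0.le (one_le_pow₀ hln))
    have hg := green_nonneg hP x y
    have h := condLaw_estimate hP le_rfl hTn hNn hxy z
    have e1 := hitProb_nonneg hP 2 x z
    have e2 := hitProb_nonneg hP 2 y z
    have e3 := hitProbMean_nonneg hP 2 x
    have e4 := hitProb_le hP le_rfl hTn x z
    have e5 := hitProb_le hP le_rfl hTn y z
    have e6 := hitProbMean_le hP le_rfl hTn x
    have h1 : (192 * (2 * Upsilon (G n)) + hitProb (G n) 2 x y) *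
          (hitProb (G n) 2 x z + hitProb (G n) 2 y z + 2 * hitProbMean (G n) 2 x) ≤
        385 * (hitProb (G n) 2 x z + hitProb (G n) 2 y z + 2 * hitProbMean (G n) 2 x) :=
      mul_le_mul_of_nonneg_right (by linarith [hitProb_le_one hP 2 x y]) (by linarith)
    have h2 : Real.exp 2 * (Real.exp (-1 * 2) * Upsilon (G n)) = Upsilon (G n) := by
      rw [← mul_assoc, ← Real.exp_add]; norm_num
    rw [mul_assoc 128, h2] at h
    have hx := green_nonneg hP x z
    have hy := green_nonneg hP y z
    rw [abs_le] at h ⊢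
    constructor <;> linarith
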